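/- Let $h$ be a complex Hilbert space and let $L$ be a densely defined, nonnegative, unbounded self-adjoint operator on $h$, with spectral measure $E^L$, which has discrete spectrum off its kernel: the operator $L^{-1}$, defined as $0$ on $\ker L$ and as the inverse of the restriction of $L$ on $(\ker L)^\perp$, is compact. Let $N_L(x):=\mathrm{Tr}\,(E^L((0,x]))$ be the eigenvalue counting function and let $\rho(L):=N_L(L)^{-1}$ be the spectral weight of $L$, which by convention is $0$ on $\ker L$. Let $e^{-\beta L}$ denote either the contraction semigroup generated by $-L$, or the same operators replaced by $0$ on $\ker L$ (the statement holds for both conventions). Suppose that the semigroup is nuclear, that is $$Z_L(\beta):=\mathrm{Tr}(e^{-\beta L})<+\infty\qquad\text{for all }\beta>0,$$ and that the partition function $Z_L$ is regularly varying at $0^+$, that is, $Z_L$ is measurable on $(0,\infty)$ and for every $s>0$ the limit $\lim_{\beta\to0^+}Z_L(s\beta)/Z_L(\beta)$ exists in $(0,+\infty)$. Then: 1. for some $c>0$ one has $N_L(x)\sim c\cdot Z_L(1/x)$ as $x\to+\infty$; 2. $N_L$ is asymptotically continuous, that is, there is a continuous $\varphi:[0,\infty)\to[0,\infty)$ with $N_L(x)\sim\varphi(x)$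 as $x\to+\infty$; 3. $\rho(L)$ is a spectral density: it is compact with $\sup_{N\ge2}\frac1{\log N}\sum_{n=1}^N\mu_n(\rho(L))<\infty$, where $\mu_n$ denotes the $n$-th singular value, its Dixmier trace $\mathrm{Tr}_\omega(\rho(L))$ does not depend on $\omega$, and $\mathrm{Tr}_\omega(\rho(L))=1$ for all $\omega$. Here $\omega$ runs through the linear functionals on the real space $L^\infty((0,\infty))$ such that $\operatorname{ess\,liminf}_{t\to+\infty}f(t)\le\omega(f)\le\operatorname{ess\,limsup}_{t\to+\infty}f(t)$ and such that $\omega(f)$ does not change when $f(t)$ is replaced by $f(st)$ or by $f(t^s)$, for any $s>0$, or by $\frac1{\log t}\int_1^tf(u)\frac{du}u$; and $\mathrm{Tr}_\omega(T)$ is the value of $\omega$ on the function $t\mapsto a_{\lfloor t\rfloor}$ with $a_N:=\frac1{\log N}\sum_{n=1}^N\mu_n(T)$ for $N\ge 2$ (and $a_0=a_1=0$). -/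

import Mathlib

open MeasureTheory Filter Topology Set Asymptotics
open scoped ENNReal InnerProductSpace

namespace SpectralWeight

set_option linter.unusedSectionVars false

noncomputable section

variable {H : Type*} [NormedAddCommGroup H] [InnerProductSpace ℂ H] [CompleteSpace H]

/-! ### Trace and singular values of bounded operators -/

/-- The sum `∑ᵢ ⟪eᵢ, T eᵢ⟫` over a Hilbert basis, with values in `[0, ∞]`. -/
def traceAlong {ι : Type*} (b : HilbertBasis ι ℂ H) (T : H →L[ℂ] H) : ℝ≥0∞ :=
  ∑' i, ENNReal.ofReal (RCLike.re ⟪b i, T (b i)⟫_ℂ)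

/-- The canonical trace of a nonnegative bounded operator `T`, with values in `[0, ∞]`:
`∑ᵢ ⟪eᵢ, T eᵢ⟫` for a Hilbert basis `(eᵢ)`.  It is used for nonnegative operators only; for these
the choice of the basis does not matter, see `trace_eq_traceAlong`. -/
def trace (T : H →L[ℂ] H) : ℝ≥0∞ :=
  traceAlong (exists_hilbertBasis ℂ H).choose_spec.choose T

/-- Parseval. -/
theorem ofReal_norm_sq_eq_tsum {ι : Type*} (b : HilbertBasis ι ℂ H) (x : H) :
    ENNReal.ofReal (‖x‖ ^ 2) = ∑' i, ENNReal.ofReal (‖⟪b i, x⟫_ℂ‖ ^ 2) := by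
  have h : HasSum (fun i => RCLike.re (⟪x, b i⟫_ℂ * ⟪b i, x⟫_ℂ)) (RCLike.re ⟪x, x⟫_ℂ) :=
    (b.hasSum_inner_mul_inner x x).mapL (RCLike.reCLM (K := ℂ))
  have h1 : ∀ i, RCLike.re (⟪x, b i⟫_ℂ * ⟪b i, x⟫_ℂ) = ‖⟪b i, x⟫_ℂ‖ ^ 2 := by
    intro i
    rw [← inner_conj_symm x (b i), RCLike.conj_mul]
    norm_cast
  simp_rw [h1] at h
  rw [inner_self_eq_norm_sq] at h
  rw [← h.tsum_eq, ENNReal.ofReal_tsum_of_nonneg (fun i => by positivity) h.summable]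

/-- The trace of a nonnegative operator may be computed along any Hilbert basis. -/
theorem trace_eq_traceAlong {ι : Type*} (b : HilbertBasis ι ℂ H) {T : H →L[ℂ] H}
    (hT : T.IsPositive) : trace T = traceAlong b T := by
  have hT0 : 0 ≤ T := (ContinuousLinearMap.nonneg_iff_isPositive T).2 hT
  set S := CFC.sqrt T with hS
  have hSS : S * S = T := CFC.sqrt_mul_sqrt_self T hT0
  have hSsym : ∀ x y : H, ⟪S x, y⟫_ℂ = ⟪x, S y⟫_ℂ :=
    ((ContinuousLinearMap.nonneg_iff_isPositive S).1 (CFC.sqrt_nonneg T)).isSymmetric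
  have key : ∀ x : H, RCLike.re ⟪x, T x⟫_ℂ = ‖S x‖ ^ 2 := by
    intro x
    rw [← hSS]
    change RCLike.re ⟪x, S (S x)⟫_ℂ = _
    rw [← hSsym, inner_self_eq_norm_sq]
  unfold trace traceAlong
  generalize (exists_hilbertBasis ℂ H).choose_spec.choose = d
  simp_rw [key]
  calc ∑' i, ENNReal.ofReal (‖S (d i)‖ ^ 2)
      = ∑' i, ∑' j, ENNReal.ofReal (‖⟪b j, S (d i)⟫_ℂ‖ ^ 2) := by
        simp_rw [← ofReal_norm_sq_eq_tsum b]
    _ = ∑' j, ∑' i, ENNReal.ofReal (‖⟪b j, S (d i)⟫_ℂ‖ ^ 2) := ENNReal.tsum_comm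
    _ = ∑' j, ENNReal.ofReal (‖S (b j)‖ ^ 2) := by
        refine tsum_congr fun j => ?_
        rw [ofReal_norm_sq_eq_tsum d]
        refine tsum_congr fun i => ?_
        rw [← hSsym, norm_inner_symm]

/-- The `n`-th singular value `μₙ(T)`, `n ≥ 1`: the distance from `T` to the operators of rank
less than `n`.  For compact `T` this is the `n`-th eigenvalue of `|T|`, in decreasing order and
counted with multiplicity. -/
def singularValue (T : H →L[ℂ] H) (n : ℕ) : ℝ :=
  sInf {r : ℝ | ∃ F : H →L[ℂ] H, F.rank < n ∧ r = ‖T - F‖}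

/-! ### Unbounded operators and their functional calculus -/

/-- `⟪L x, x⟫ ≥ 0` on the domain of `L`. -/
def IsNonnegOp (L : H →ₗ.[ℂ] H) : Prop :=
  ∀ x : L.domain, 0 ≤ RCLike.re ⟪L x, (x : H)⟫_ℂ

/-- `L` is unbounded. -/
def IsUnboundedOp (L : H →ₗ.[ℂ] H) : Prop :=
  ∀ C : ℝ, ∃ x : L.domain, C * ‖(x : H)‖ < ‖L x‖

/-- The kernel of `L`, as a subspace of `H`. -/
def kernel (L : H →ₗ.[ℂ] H) : Submodule ℂ H := (LinearMap.ker L.toFun).map L.domain.subtype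

/-- `L` has discrete spectrum off its kernel: the inverse `L⁻¹` of the restriction of `L` to the
orthogonal complement of `ker L`, extended by `0` on `ker L`, is a compact operator. -/
def HasDiscreteSpectrumOffKernel (L : H →ₗ.[ℂ] H) : Prop :=
  ∃ K : H →L[ℂ] H, IsCompactOperator K ∧ (∀ x ∈ kernel L, K x = 0) ∧
    ∀ x ∈ (kernel L)ᗮ, K x ∈ (kernel L)ᗮ ∧ (K x, x) ∈ L.graph

/-- `R = (1 + L)⁻¹`: one has `R x = y` if and only if `y ∈ D(L)` and `y + L y = x`. -/
def IsResolvent (L : H →ₗ.[ℂ] H) (R : H →L[ℂ] H) : Prop :=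
  ∀ x y : H, R x = y ↔ (y, x - y) ∈ L.graph

/-- The resolvent of a nonnegative self-adjoint operator exists. -/
theorem exists_isResolvent {L : H →ₗ.[ℂ] H} (hself : IsSelfAdjoint L) (hnonneg : IsNonnegOp L) :
    ∃ R : H →L[ℂ] H, IsResolvent L R := by
  have hdense := hself.dense_domain
  have hclosed : IsClosed (L.graph : Set (H × H)) := hself.isClosed
  have : CompleteSpace L.graph := hclosed.completeSpace_coe
  have hnn : ∀ x y : H, (x, y) ∈ L.graph → 0 ≤ RCLike.re ⟪y, x⟫_ℂ := by
    intro x y h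
    obtain ⟨u, rfl, rfl⟩ := (LinearPMap.mem_graph_iff L).1 h
    exact hnonneg u
  have hb : ∀ x y : H, (x, y) ∈ L.graph → ‖x‖ ≤ ‖x + y‖ := by
    intro x y h
    have h1 : ‖x‖ * ‖x‖ ≤ RCLike.re ⟪x + y, x⟫_ℂ := by
      rw [inner_add_left, map_add, inner_self_eq_norm_mul_norm]
      linarith [hnn x y h]
    have h2 := (h1.trans (RCLike.re_le_norm _)).trans (norm_inner_le_norm (x + y) x)
    rcases (norm_nonneg x).eq_or_lt with h0 | h0
    · rw [← h0]; positivity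
    · exact le_of_mul_le_mul_right h2 h0
  let φ : L.graph →L[ℂ] H :=
    (ContinuousLinearMap.fst ℂ H H + ContinuousLinearMap.snd ℂ H H).comp L.graph.subtypeL
  have hφ : ∀ p : L.graph, φ p = p.1.1 + p.1.2 := fun p => rfl
  have hanti : AntilipschitzWith 2 φ := by
    refine ContinuousLinearMap.antilipschitz_of_bound φ fun p => ?_
    obtain ⟨⟨x, y⟩, hp⟩ := p
    have hx := hb x y hp
    have hy : ‖y‖ ≤ ‖x + y‖ + ‖x‖ := by
      simpa using norm_sub_le (x + y) x
    rw [hφ]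
    change max ‖x‖ ‖y‖ ≤ 2 * ‖x + y‖
    exact max_le (by linarith [norm_nonneg (x + y)]) (by linarith)
  have hrc : IsClosed (Set.range φ) := hanti.isClosed_range φ.uniformContinuous
  have hbot : (LinearMap.range φ.toLinearMap)ᗮ = ⊥ := by
    rw [Submodule.eq_bot_iff]
    intro z hz
    rw [Submodule.mem_orthogonal'] at hz
    have hz' : ∀ x : L.domain, ⟪-z, (x : H)⟫_ℂ = ⟪z, L x⟫_ℂ := by
      intro x
      have h := hz (x + L x) ⟨⟨(x, L x), L.mem_graph x⟩, rfl⟩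
      rw [inner_add_right] at h
      rw [inner_neg_left]
      linear_combination -h
    have hmem := L.mem_adjoint_domain_of_exists z ⟨-z, hz'⟩
    have happ := LinearPMap.adjoint_apply_eq hdense ⟨z, hmem⟩ hz'
    have hg : (z, -z) ∈ (LinearPMap.adjoint L).graph := by
      have := (LinearPMap.adjoint L).mem_graph ⟨z, hmem⟩
      rwa [happ] at this
    rw [LinearPMap.isSelfAdjoint_def.1 hself] at hg
    have := hb z (-z) hg
    simpa using this
  have hsurj : Function.Surjective φ := by
    have : (LinearMap.range φ.toLinearMap).topologicalClosure = ⊤ :=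
      (Submodule.topologicalClosure_eq_top_iff).2 hbot
    rw [IsClosed.submodule_topologicalClosure_eq hrc] at this
    exact LinearMap.range_eq_top.1 this
  let e := ContinuousLinearEquiv.ofBijective φ (LinearMap.ker_eq_bot.2 hanti.injective)
    (LinearMap.range_eq_top.2 hsurj)
  have he : ∀ p, e p = φ p := fun p => rfl
  refine ⟨((ContinuousLinearMap.fst ℂ H H).comp L.graph.subtypeL).comp
    (e.symm : H →L[ℂ] L.graph), fun x y => ?_⟩
  have hx : (e.symm x).1.1 + (e.symm x).1.2 = x := by
    rw [← hφ, ← he, e.apply_symm_apply]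
  change (e.symm x).1.1 = y ↔ _
  constructor
  · rintro rfl
    have h : (e.symm x).1.2 = x - (e.symm x).1.1 := by rw [eq_sub_iff_add_eq', hx]
    rw [← h]
    exact (e.symm x).2
  · intro h
    have : e ⟨(y, x - y), h⟩ = x := by rw [he, hφ]; simp
    rw [← this, e.symm_apply_apply]

open Classical in
/-- The bounded operator `(1 + L)⁻¹`; it exists when `L` is self-adjoint and nonnegative, see
`exists_isResolvent`. -/
def resolvent (L : H →ₗ.[ℂ] H) : H →L[ℂ] H :=
  if h : ∃ R : H →L[ℂ] H, IsResolvent L R then h.choose else 0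

/-- The operator `f(L)`, for a self-adjoint `L ≥ 0` with discrete spectrum off its kernel, with
the convention that `f(L)` vanishes on `ker L`.

The spectral points `λ ∈ [0, ∞)` of `L` correspond to the spectral points `r = 1 / (1 + λ)` of
`R = (1 + L)⁻¹`, that is `λ = r⁻¹ - 1`, so `f(L)` is obtained from the continuous functional
calculus of the bounded self-adjoint operator `R`.  The point `r = 1` corresponds to `λ = 0` and the
point `r = 0` to `λ = ∞`. As the spectrum of `L` off the kernel is a discrete set `{λ̃ₖ}`
accumulating only at infinity, the transported function is continuous on the spectrum of `R`
as soon as `f` tends to `0` along the spectrum of `L`, whether or not `f` itself is continuous. -/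
def functionOf (L : H →ₗ.[ℂ] H) (f : ℝ → ℝ) : H →L[ℂ] H :=
  cfc (fun r : ℝ => if 0 < r ∧ r < 1 then f (r⁻¹ - 1) else 0) (resolvent L)

/-- The operator `e^{-tL}`, `t > 0`, of the contraction semigroup generated by `-L`; it is the
identity on `ker L`. -/
def heatSemigroup (L : H →ₗ.[ℂ] H) (t : ℝ) : H →L[ℂ] H :=
  cfc (fun r : ℝ => if 0 < r then Real.exp (-t * (r⁻¹ - 1)) else 0) (resolvent L)

/-- The operator `e^{-tL}`, `t > 0`, formed with the convention that functions of `L` vanish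
on `ker L`. -/
def heatSemigroupOffKernel (L : H →ₗ.[ℂ] H) (t : ℝ) : H →L[ℂ] H :=
  functionOf L (fun x => Real.exp (-t * x))

/-- The spectral projection `E^L((0, x])`. -/
def spectralProjection (L : H →ₗ.[ℂ] H) (x : ℝ) : H →L[ℂ] H :=
  functionOf L ((Ioc 0 x).indicator 1)

/-- The eigenvalue counting function `N_L(x) = Tr (E^L((0, x]))`. -/
def countingFunction (L : H →ₗ.[ℂ] H) (x : ℝ) : ℝ := (trace (spectralProjection L x)).toReal

/-- The spectral weight `ρ(L) = N_L(L)⁻¹`. -/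
def weight (L : H →ₗ.[ℂ] H) : H →L[ℂ] H := functionOf L (fun x => (countingFunction L x)⁻¹)

/-! ### Dixmier traces -/

/-- Lebesgue measure on `(0, ∞)`. -/
def posMeasure : Measure ℝ := volume.restrict (Ioi 0)

/-- The essential neighbourhoods of `+∞` in `(0, ∞)`. -/
def essAtTop : Filter ℝ := atTop ⊓ ae posMeasure

/-- A dilation, power and logarithmic Cesàro invariant limit process `ω` at `+∞` on the real part
of `L^∞((0, ∞))`.  Positivity and `ω 1 = 1` are contained in the first two properties. -/
structure DixmierState where
  toLinearMap : Lp ℝ ∞ posMeasure →ₗ[ℝ] ℝ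
  liminf_le : ∀ f : Lp ℝ ∞ posMeasure, liminf (f : ℝ → ℝ) essAtTop ≤ toLinearMap f
  le_limsup : ∀ f : Lp ℝ ∞ posMeasure, toLinearMap f ≤ limsup (f : ℝ → ℝ) essAtTop
  dilation : ∀ s : ℝ, 0 < s → ∀ f g : Lp ℝ ∞ posMeasure,
    (∀ᵐ t ∂posMeasure, g t = f (s * t)) → toLinearMap g = toLinearMap f
  power : ∀ s : ℝ, 0 < s → ∀ f g : Lp ℝ ∞ posMeasure,
    (∀ᵐ t ∂posMeasure, g t = f (t ^ s)) → toLinearMap g = toLinearMap f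
  cesaro : ∀ f g : Lp ℝ ∞ posMeasure,
    (∀ᵐ t ∂posMeasure, g t = (Real.log t)⁻¹ * ∫ u in (1 : ℝ)..t, f u / u) →
      toLinearMap g = toLinearMap f

/-- The logarithmic means `(1 / log N) ∑_{n = 1}^N μₙ(T)`. -/
def logMean (T : H →L[ℂ] H) (N : ℕ) : ℝ :=
  (Real.log N)⁻¹ * ∑ n ∈ Finset.Icc 1 N, singularValue T n

/-- The dual Macaev ideal `𝓛^{(1, ∞)}`. -/
def MemMacaev (T : H →L[ℂ] H) : Prop :=
  IsCompactOperator T ∧ BddAbove (logMean T '' Ici 2)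

open Classical in
/-- The Dixmier trace `Tr_ω(T) = ω-lim_N (1 / log N) ∑_{n = 1}^N μₙ(T)` of a nonnegative operator
in `𝓛^{(1, ∞)}`.  The limit of a sequence `a` is `ω` applied to `t ↦ a ⌊t⌋`, a class
in `L^∞((0, ∞))` when `T` is in `𝓛^{(1, ∞)}`. -/
def dixmierTrace (ω : DixmierState) (T : H →L[ℂ] H) : ℝ :=
  if h : MemLp (fun t : ℝ => logMean T ⌊t⌋₊) ∞ posMeasure then ω.toLinearMap h.toLp else 0

/-- A nonnegative `T` in `𝓛^{(1, ∞)}` is measurable if `Tr_ω(T)` does not depend on `ω`. -/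
def IsMeasurableOp (T : H →L[ℂ] H) : Prop :=
  MemMacaev T ∧ ∀ ω ω' : DixmierState, dixmierTrace ω T = dixmierTrace ω' T

/-- The spectral weight `ρ(L)` is a spectral density. -/
def WeightIsDensity (L : H →ₗ.[ℂ] H) : Prop :=
  IsMeasurableOp (weight L) ∧ ∀ ω : DixmierState, dixmierTrace ω (weight L) = 1

/-! ### Regular variation and asymptotic continuity -/

/-- `f`, defined on `(0, ∞)`, is regularly varying at `0⁺`. -/
def IsRegularlyVaryingAtZero (f : ℝ → ℝ) : Prop :=
  Measurable (fun t : Ioi (0 : ℝ) => f t) ∧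
    ∀ s : ℝ, 0 < s → ∃ k : ℝ, 0 < k ∧ Tendsto (fun t => f (s * t) / f t) (𝓝[>] 0) (𝓝 k)

/-- `f` is asymptotic at `+∞` to a continuous function `φ : [0, ∞) → [0, ∞)`. -/
def IsAsymptoticallyContinuous (f : ℝ → ℝ) : Prop :=
  ∃ φ : ℝ → ℝ, ContinuousOn φ (Ici 0) ∧ (∀ x, 0 ≤ x → 0 ≤ φ x) ∧ f ~[atTop] φ

end

end SpectralWeight

open SpectralWeight

set_option linter.unusedSectionVars false

/-! Discreteness makes `L` diagonal: a Hilbert basis of eigenvectors exists, with positive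
eigenvalues `a j`, only finitely many below any level, besides the kernel. Hence `N_L(x)` counts the
`j` with `a j ≤ x`, and `Z_L(β)` is `W(β) = ∑ exp(-β a j)` plus a finite constant from the kernel.
Unboundedness makes the family infinite, so `W → ∞` at `0⁺`; the constant is negligible and `W` is
regularly varying too.

Parts 1 and 2 are Karamata's Tauberian theorem, `exists_tendsto_ncard_div_partitionSum`. As `W` is
antitone, the limit ratios are `s ^ (-d)` with `d ≥ 0`. Put mass `exp(-β a j) / W(β)` at the point
`exp(-β a j)` of `[0, 1]`: the `m`-th moment of this probability measure is `W((m+1)β) / W(β)`,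
which tends to `(m+1) ^ (-d)`, the `m`-th moment of a fixed measure `ν`. The ratio `N_L(1/β) / W(β)`
is the integral of `u⁻¹` cut off below `exp(-1)`. Its jump is not charged by `ν`, so polynomials
squeeze it from both sides and the ratio converges to a positive constant. Since `W` is continuous,
`N_L` is asymptotically continuous.

For part 3, fewer than `n` eigenvalues satisfy `N_L(a j) < n`, so always `μₙ(ρ(L)) ≤ 1/n`.
Asymptotic continuity rules out large relative jumps of `N_L`: some value lies in `[n, (1+ε)n]`,
whence `μₙ ≥ 1/((1+ε)n)`. Thus `n μₙ → 1`, the logarithmic means converge to `1`, and every `ω`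
takes the value `1`. -/

namespace SpectralWeight

/-! ### Operators diagonal in a Hilbert basis: spectrum and functional calculus. -/

section Diagonal

variable {H : Type*} [NormedAddCommGroup H] [InnerProductSpace ℂ H] [CompleteSpace H]
  {ι : Type*} (b : HilbertBasis ι ℂ H)

/-- Parseval's identity. -/
theorem hasSum_norm_inner_sq (x : H) : HasSum (fun i => ‖⟪b i, x⟫_ℂ‖ ^ 2) (‖x‖ ^ 2) := by
  have h : HasSum (fun i => RCLike.re (⟪x, b i⟫_ℂ * ⟪b i, x⟫_ℂ)) (RCLike.re ⟪x, x⟫_ℂ) :=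
    (b.hasSum_inner_mul_inner x x).mapL (RCLike.reCLM (K := ℂ))
  rw [inner_self_eq_norm_sq] at h
  convert h using 2 with i
  rw [← inner_conj_symm x (b i), RCLike.conj_mul]
  norm_cast

/-- Coordinatewise comparison of norms. -/
theorem norm_le_of_norm_inner_le {C : ℝ} (hC : 0 ≤ C) {x y : H}
    (h : ∀ i, ‖⟪b i, y⟫_ℂ‖ ≤ C * ‖⟪b i, x⟫_ℂ‖) : ‖y‖ ≤ C * ‖x‖ := by
  have h1 := hasSum_norm_inner_sq b y
  have h2 := (hasSum_norm_inner_sq b x).mul_left (C ^ 2)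
  have h3 : ‖y‖ ^ 2 ≤ C ^ 2 * ‖x‖ ^ 2 := hasSum_le (fun i => by
    rw [← mul_pow]; exact pow_le_pow_left₀ (norm_nonneg _) (h i) 2) h1 h2
  rw [← mul_pow] at h3
  exact (abs_le_of_sq_le_sq' h3 (by positivity)).2

variable {b} {T : H →L[ℂ] H} {t : ι → ℝ}

/-- The matrix coefficients of a symmetric diagonal operator. -/
theorem inner_apply_of_diagonal (hT : ∀ x y, ⟪T x, y⟫_ℂ = ⟪x, T y⟫_ℂ)
    (ht : ∀ i, T (b i) = (t i : ℂ) • b i) (i : ι) (x : H) :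
    ⟪b i, T x⟫_ℂ = t i * ⟪b i, x⟫_ℂ := by
  rw [← hT, ht, inner_smul_left, Complex.conj_ofReal]

/-- The spectrum of a diagonal operator is contained in the closure of its diagonal. -/
theorem spectrum_subset_closure_range (hT : ∀ x y, ⟪T x, y⟫_ℂ = ⟪x, T y⟫_ℂ)
    (ht : ∀ i, T (b i) = (t i : ℂ) • b i) : spectrum ℝ T ⊆ closure (range t) := by
  intro z hz
  by_contra hcl
  obtain ⟨δ, hδ, hball⟩ : ∃ δ > 0, ∀ i, δ ≤ |z - t i| := by
    rw [Metric.mem_closure_iff] at hcl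
    push Not at hcl
    obtain ⟨δ, hδ, h⟩ := hcl
    exact ⟨δ, hδ, fun i => h _ ⟨i, rfl⟩⟩
  apply hz
  set A : H →L[ℂ] H := algebraMap ℝ (H →L[ℂ] H) z - T with hA
  have hAx : ∀ x, A x = (z : ℂ) • x - T x := by
    intro x
    simp [hA, Algebra.algebraMap_eq_smul_one]
  have hAsym : ∀ x y, ⟪A x, y⟫_ℂ = ⟪x, A y⟫_ℂ := by
    intro x y
    rw [hAx, hAx, inner_sub_left, inner_sub_right, inner_smul_left, inner_smul_right, hT,
      Complex.conj_ofReal]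
  have hAd : ∀ i, A (b i) = ((z - t i : ℝ) : ℂ) • b i := by
    intro i
    rw [hAx, ht, Complex.ofReal_sub, sub_smul]
  have hAb : ∀ x, ‖x‖ ≤ δ⁻¹ * ‖A x‖ := by
    intro x
    refine norm_le_of_norm_inner_le b (by positivity) fun i => ?_
    rw [inner_apply_of_diagonal hAsym hAd, norm_mul, Complex.norm_real, Real.norm_eq_abs,
      inv_mul_eq_div, le_div_iff₀ hδ, mul_comm]
    exact mul_le_mul_of_nonneg_right (hball i) (norm_nonneg _)
  -- The invertibility criterion needs a lower bound on the quadratic form. That of `A` may change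
  -- sign, but that of `A ^ 2` is `‖A x‖ ^ 2 ≥ δ ^ 2 * ‖x‖ ^ 2`.
  have hu : IsUnit (A ^ 2) := by
    refine ContinuousLinearMap.isUnit_of_forall_le_norm_inner_map (A ^ 2)
      (c := Real.toNNReal (δ ^ 2)) (Real.toNNReal_pos.2 (by positivity)) fun x => ?_
    have h1 : (A ^ 2) x = A (A x) := by rw [pow_two]; rfl
    rw [h1, hAsym, inner_self_eq_norm_sq_to_K, norm_pow]
    rw [Real.coe_toNNReal _ (by positivity)]
    have h2 := hAb x
    rw [inv_mul_eq_div, le_div_iff₀ hδ] at h2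
    rw [← mul_pow]
    refine pow_le_pow_left₀ (by positivity) (h2.trans (le_of_eq ?_)) 2
    simp
  exact (isUnit_pow_iff two_ne_zero).1 hu

/-- The continuous functional calculus acts on eigenvectors as expected. -/
theorem cfc_apply_eigenvector (hT : IsSelfAdjoint T) {x : H} {s : ℝ} (hx0 : x ≠ 0)
    (hx : T x = (s : ℂ) • x) {f : ℝ → ℝ} (hf : ContinuousOn f (spectrum ℝ T)) :
    cfc f T x = (f s : ℂ) • x := by
  have hs : s ∈ spectrum ℝ T := by
    intro hu
    obtain ⟨u, hu⟩ := hu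
    have h0 : (u : H →L[ℂ] H) x = 0 := by
      rw [hu]
      simp [Algebra.algebraMap_eq_smul_one, hx]
    have : ((u⁻¹ : (H →L[ℂ] H)ˣ) : H →L[ℂ] H) ((u : H →L[ℂ] H) x) = x := by
      change (((u⁻¹ : (H →L[ℂ] H)ˣ) : H →L[ℂ] H) * (u : H →L[ℂ] H)) x = x
      rw [u.inv_mul]; rfl
    rw [h0, map_zero] at this
    exact hx0 this.symm
  -- Stone–Weierstrass: the identity holds for constants and the coordinate, survives sums and
  -- products, and is closed in `g`.
  have key : ∀ g : C(spectrum ℝ T, ℝ), cfcHom hT g x = (g ⟨s, hs⟩ : ℂ) • x := by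
    intro g
    induction g using ContinuousMap.induction_on_of_compact with
    | const r =>
      have : ContinuousMap.const (spectrum ℝ T) r = algebraMap ℝ C(spectrum ℝ T, ℝ) r := rfl
      rw [this, AlgHomClass.commutes]
      simp [Algebra.algebraMap_eq_smul_one]
    | id => rw [cfcHom_id hT, hx]; rfl
    | star_id =>
      rw [star_trivial, cfcHom_id hT, hx]; rfl
    | add f g hf hg => simp [map_add, hf, hg, add_smul]
    | mul f g hf hg =>
      rw [map_mul, mul_apply_eq_comp, hg, map_smul, hf, smul_smul]
      simp [mul_comm]
    | frequently f h =>
      have h1 : IsClosed {g : C(spectrum ℝ T, ℝ) | cfcHom hT g x = (g ⟨s, hs⟩ : ℂ) • x} := by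
        refine isClosed_eq ?_ ?_
        · exact (ContinuousLinearMap.apply ℂ H x).continuous.comp (cfcHom_continuous hT)
        · exact (Complex.continuous_ofReal.comp (ContinuousEvalConst.continuous_eval_const _)).smul
            continuous_const
      exact h1.closure_subset (mem_closure_iff_frequently.2 h)
  rw [cfc_apply f T hT hf, key]
  rfl

end Diagonal

/-! ### Compact symmetric operators, the resolvent, and the eigenbasis of `L`. -/

/-- A compact symmetric operator has a Hilbert basis of eigenvectors. -/
theorem exists_hilbertBasis_eigenvectors.{u} {H : Type u} [NormedAddCommGroup H]
    [InnerProductSpace ℂ H] [CompleteSpace H] {T : H →L[ℂ] H} (hT : IsCompactOperator T)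
    (hsym : T.IsSymmetric) :
    ∃ (ι : Type u) (b : HilbertBasis ι ℂ H) (c : ι → ℂ), ∀ i, T (b i) = c i • b i := by
  -- All `μ : ℂ` are treated alike; a non-eigenvalue contributes the basis of a zero space, which is
  -- empty.
  have hex : ∀ μ : ℂ, ∃ (w : Set (Module.End.eigenspace (T : Module.End ℂ H) μ))
      (d : HilbertBasis w ℂ (Module.End.eigenspace (T : Module.End ℂ H) μ)), ⇑d = Subtype.val := by
    intro μ
    have : IsClosed (Module.End.eigenspace (T : Module.End ℂ H) μ : Set H) := by
      have : (Module.End.eigenspace (T : Module.End ℂ H) μ : Set H) = {x | T x = μ • x} := by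
        ext x; simp
      rw [this]
      exact isClosed_eq T.continuous (continuous_const_smul μ)
    have := this.completeSpace_coe
    exact exists_hilbertBasis ℂ _
  choose w d hd using hex
  have hon := hsym.orthogonalFamily_eigenspaces.orthonormal_sigma_orthonormal
    (v_family := fun μ => d μ) (fun μ => (d μ).orthonormal)
  have hbot : (Submodule.span ℂ (range fun a : Σ μ, w μ =>
      (Module.End.eigenspace (T : Module.End ℂ H) a.1).subtypeₗᵢ (d a.1 a.2)))ᗮ = ⊥ := by
    rw [← ContinuousLinearMap.orthogonalComplement_iSup_eigenspaces_eq_bot hT hsym]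
    refine le_antisymm (fun x hx => ?_) (Submodule.orthogonal_le ?_)
    · rw [Submodule.mem_orthogonal'] at hx
      rw [← Submodule.iInf_orthogonal, Submodule.mem_iInf]
      intro μ
      rw [Submodule.mem_orthogonal']
      intro v hv
      have h := ((d μ).hasSum_repr ⟨v, hv⟩).mapL
        ((innerSL ℂ x).comp (Module.End.eigenspace (T : Module.End ℂ H) μ).subtypeL)
      refine h.unique (hasSum_zero.congr_fun fun i => ?_)
      rw [map_smul, smul_eq_mul]
      exact mul_eq_zero_of_right _ (hx _ (Submodule.subset_span ⟨⟨μ, i⟩, rfl⟩))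
    · rw [Submodule.span_le]
      rintro _ ⟨a, rfl⟩
      exact Submodule.mem_iSup_of_mem a.1 (d a.1 a.2).2
  refine ⟨_, HilbertBasis.mkOfOrthogonalEqBot hon hbot, fun a => a.1, fun a => ?_⟩
  rw [HilbertBasis.coe_mkOfOrthogonalEqBot]
  exact Module.End.mem_eigenspace_iff.1 (d a.1 a.2).2

section Operator

variable {H : Type*} [NormedAddCommGroup H] [InnerProductSpace ℂ H] [CompleteSpace H]
  {L : H →ₗ.[ℂ] H}

theorem isResolvent_resolvent (hself : IsSelfAdjoint L) (hnonneg : IsNonnegOp L) :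
    IsResolvent L (resolvent L) := by
  have h := exists_isResolvent hself hnonneg
  rw [resolvent, dif_pos h]
  exact h.choose_spec

theorem inner_graph_symm (hself : IsSelfAdjoint L) {x y x' y' : H} (h : (x, y) ∈ L.graph)
    (h' : (x', y') ∈ L.graph) : ⟪y, x'⟫_ℂ = ⟪x, y'⟫_ℂ := by
  obtain ⟨u, rfl, rfl⟩ := (LinearPMap.mem_graph_iff L).1 h
  obtain ⟨v, rfl, rfl⟩ := (LinearPMap.mem_graph_iff L).1 h'
  have := LinearPMap.adjoint_isFormalAdjoint hself.dense_domain
  rw [LinearPMap.isSelfAdjoint_def.1 hself] at this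
  exact this u v

theorem re_inner_graph_nonneg (hnonneg : IsNonnegOp L) {x y : H} (h : (x, y) ∈ L.graph) :
    0 ≤ RCLike.re ⟪y, x⟫_ℂ := by
  obtain ⟨u, rfl, rfl⟩ := (LinearPMap.mem_graph_iff L).1 h
  exact hnonneg u

theorem mem_kernel_iff {x : H} : x ∈ kernel L ↔ (x, (0 : H)) ∈ L.graph := by
  rw [kernel, Submodule.mem_map, LinearPMap.mem_graph_iff]
  constructor
  · rintro ⟨u, hu, rfl⟩
    exact ⟨u, rfl, hu⟩
  · rintro ⟨u, rfl, hu⟩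
    exact ⟨u, hu, rfl⟩

theorem IsResolvent.mem_graph {R : H →L[ℂ] H} (hR : IsResolvent L R) (x : H) :
    (R x, x - R x) ∈ L.graph := (hR x (R x)).1 rfl

theorem IsResolvent.isSymmetric {R : H →L[ℂ] H} (hR : IsResolvent L R)
    (hself : IsSelfAdjoint L) : R.IsSymmetric := by
  intro x y
  have h := inner_graph_symm hself (hR.mem_graph x) (hR.mem_graph y)
  rw [inner_sub_left, inner_sub_right] at h
  change ⟪R x, y⟫_ℂ = ⟪x, R y⟫_ℂ
  linear_combination -h

theorem IsResolvent.apply_eq_self_iff {R : H →L[ℂ] H} (hR : IsResolvent L R) {x : H} :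
    R x = x ↔ x ∈ kernel L := by
  rw [hR x x, mem_kernel_iff, sub_self]

theorem IsResolvent.eq_zero {R : H →L[ℂ] H} (hR : IsResolvent L R) {x : H} (h : R x = 0) :
    x = 0 := by
  have := (hR x 0).1 h
  rw [sub_zero] at this
  exact L.graph_fst_eq_zero_snd this rfl

theorem IsResolvent.isClosed_kernel {R : H →L[ℂ] H} (hR : IsResolvent L R) :
    IsClosed (kernel L : Set H) := by
  have : (kernel L : Set H) = {x | R x = x} := by
    ext x
    simp [hR.apply_eq_self_iff]
  rw [this]
  exact isClosed_eq R.continuous continuous_id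

/-- For a vector orthogonal to the kernel, `L⁻¹ (1 - R) = R` where `R = (1 + L)⁻¹`. -/
theorem IsResolvent.apply_sub_eq {R K : H →L[ℂ] H} (hR : IsResolvent L R)
    (hself : IsSelfAdjoint L)
    (hK : ∀ x ∈ (kernel L)ᗮ, K x ∈ (kernel L)ᗮ ∧ (K x, x) ∈ L.graph) {x : H}
    (hx : x ∈ (kernel L)ᗮ) : K (x - R x) = R x := by
  have hRx : R x ∈ (kernel L)ᗮ := by
    rw [Submodule.mem_orthogonal']
    intro k hk
    have h := hR.isSymmetric hself x k
    change ⟪R x, k⟫_ℂ = ⟪x, R k⟫_ℂ at h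
    rw [h, hR.apply_eq_self_iff.2 hk]
    exact (Submodule.mem_orthogonal' _ _).1 hx k hk
  obtain ⟨h1, h2⟩ := hK _ (Submodule.sub_mem _ hx hRx)
  -- `K (x - R x)` and `R x` have the same image under `L`, so their difference lies in the kernel;
  -- it is also orthogonal to it.
  have h3 := L.graph.sub_mem h2 (hR.mem_graph x)
  rw [Prod.mk_sub_mk, sub_self, ← mem_kernel_iff] at h3
  have h4 := Submodule.sub_mem _ h1 hRx
  have h5 := (Submodule.mem_orthogonal _ _).1 h4 _ h3
  exact sub_eq_zero.1 (inner_self_eq_zero.1 h5)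

end Operator

/-- A nonnegative self-adjoint operator with discrete spectrum off its kernel has a Hilbert basis of
eigenvectors; the eigenvalues `r i` of `(1 + L)⁻¹` lie in `(0, 1]` and accumulate at `0` only,
apart from the possibly infinite multiplicity of `1`. -/
theorem exists_eigenbasis.{u} {H : Type u} [NormedAddCommGroup H] [InnerProductSpace ℂ H]
    [CompleteSpace H] {L : H →ₗ.[ℂ] H} (hself : IsSelfAdjoint L) (hnonneg : IsNonnegOp L)
    (hdisc : HasDiscreteSpectrumOffKernel L) :
    ∃ (ι : Type u) (b : HilbertBasis ι ℂ H) (r : ι → ℝ), (∀ i, 0 < r i ∧ r i ≤ 1) ∧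
      (∀ i, resolvent L (b i) = (r i : ℂ) • b i) ∧
      ∀ ε : ℝ, 0 < ε → {i | ε ≤ r i ∧ r i < 1}.Finite := by
  have hR := isResolvent_resolvent hself hnonneg
  set R := resolvent L
  have hRsym := hR.isSymmetric hself
  obtain ⟨K, hKc, hK0, hK⟩ := hdisc
  have := hR.isClosed_kernel.completeSpace_coe
  set P : H →L[ℂ] H := (kernel L).starProjection with hP
  -- `R` is the identity on the kernel, so it is not compact when the kernel is
  -- infinite-dimensional. Subtracting the kernel projection leaves `K (1 - R)`, which is compact.
  set C : H →L[ℂ] H := R - P with hC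
  have hCK : C = K.comp (1 - R) := by
    ext x
    have hp : P x ∈ kernel L := Submodule.starProjection_apply_mem _ _
    have hq : x - P x ∈ (kernel L)ᗮ := Submodule.sub_starProjection_mem_orthogonal x
    have h1 := hR.apply_sub_eq hself hK hq
    have h2 : R (x - P x) = R x - P x := by rw [map_sub, hR.apply_eq_self_iff.2 hp]
    rw [h2] at h1
    change R x - P x = K (x - R x)
    rw [← h1]
    congr 1
    abel
  have hCc : IsCompactOperator C := by
    rw [hCK]
    exact hKc.comp_clm _
  have hCsym : C.IsSymmetric := hRsym.sub (Submodule.starProjection_isSymmetric _)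
  obtain ⟨ι, b, c, hc⟩ := exists_hilbertBasis_eigenvectors hCc hCsym
  have hb1 : ∀ i, ‖b i‖ = 1 := fun i => b.orthonormal.1 i
  have hb0 : ∀ i, b i ≠ 0 := fun i h => by simpa [h] using hb1 i
  -- If `C (b i) = 0`, then `R` kills `b i - P (b i)`, and `R` is injective. Otherwise `b i` is
  -- orthogonal to the kernel, because the symmetric `C` vanishes there.
  have hcases : ∀ i, (b i ∈ kernel L) ∨ (b i ∈ (kernel L)ᗮ) := by
    intro i
    by_cases h : c i = 0
    · left
      have h1 : C (b i) = 0 := by rw [hc, h, zero_smul]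
      have h2 : R (b i) = P (b i) := sub_eq_zero.1 h1
      have h3 : P (b i) ∈ kernel L := Submodule.starProjection_apply_mem _ _
      have h4 : R (b i - P (b i)) = 0 := by
        rw [map_sub, hR.apply_eq_self_iff.2 h3, h2, sub_self]
      rw [sub_eq_zero.1 (hR.eq_zero h4)]
      exact h3
    · right
      rw [Submodule.mem_orthogonal]
      intro k hk
      have h1 := hCsym k (b i)
      change ⟪C k, b i⟫_ℂ = ⟪k, C (b i)⟫_ℂ at h1
      have h2 : C k = 0 := by
        change R k - P k = 0
        rw [hR.apply_eq_self_iff.2 hk, hP, Submodule.starProjection_eq_self_iff.2 hk, sub_self]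
      rw [h2, inner_zero_left, hc, inner_smul_right] at h1
      exact (mul_eq_zero.1 h1.symm).resolve_left h
  have hCorth : ∀ i, b i ∈ (kernel L)ᗮ → C (b i) = R (b i) := by
    intro i hi
    change R (b i) - P (b i) = _
    rw [hP, (Submodule.starProjection_apply_eq_zero_iff _).2 hi, sub_zero]
  have hReig : ∀ i, ∃ ρ : ℂ, R (b i) = ρ • b i := by
    intro i
    rcases hcases i with h | h
    · exact ⟨1, by rw [one_smul, hR.apply_eq_self_iff.2 h]⟩
    · exact ⟨c i, by rw [← hCorth i h, hc]⟩
  choose ρ hρ using hReig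
  have hρr : ∀ i, ((ρ i).re : ℂ) = ρ i := by
    intro i
    have h := hRsym (b i) (b i)
    change ⟪R (b i), b i⟫_ℂ = ⟪b i, R (b i)⟫_ℂ at h
    rw [hρ, inner_smul_left, inner_smul_right, inner_self_eq_norm_sq_to_K, hb1] at h
    simp only [Complex.coe_algebraMap, Complex.ofReal_one, one_pow, mul_one] at h
    exact Complex.conj_eq_iff_re.1 h
  have hr : ∀ i, R (b i) = ((ρ i).re : ℂ) • b i := fun i => by rw [hρr, hρ]
  have hpos : ∀ i, 0 < (ρ i).re ∧ (ρ i).re ≤ 1 := by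
    intro i
    have h := re_inner_graph_nonneg hnonneg (hR.mem_graph (b i))
    rw [hr, inner_smul_right, inner_sub_left, inner_smul_left, inner_self_eq_norm_sq_to_K,
      hb1, Complex.conj_ofReal] at h
    have h' : 0 ≤ (ρ i).re * (1 - (ρ i).re) := by
      simpa using h
    have hne : (ρ i).re ≠ 0 := by
      intro h0
      refine hb0 i (hR.eq_zero ?_)
      rw [hr, h0, Complex.ofReal_zero, zero_smul]
    have : (0 : ℝ) ≤ (ρ i).re := by nlinarith
    have h0 : 0 < (ρ i).re := lt_of_le_of_ne this hne.symm
    exact ⟨h0, by nlinarith⟩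
  refine ⟨ι, b, fun i => (ρ i).re, hpos, hr, fun ε hε => ?_⟩
  -- Infinitely many such `b i` would have images under `C` at pairwise distance at least `ε`,
  -- inside the totally bounded image of the unit ball. Pigeonhole on a cover by `ε / 2`-balls
  -- contradicts this.
  by_contra hinf
  have hcomp : TotallyBounded (C '' Metric.closedBall 0 1) :=
    (hCc.isCompact_closure_image_closedBall 1).totallyBounded.subset subset_closure
  obtain ⟨t, ht, hcov⟩ := Metric.totallyBounded_iff.1 hcomp (ε / 2) (by positivity)
  have hmem : ∀ i ∈ {i | ε ≤ (ρ i).re ∧ (ρ i).re < 1}, ∃ y ∈ t, dist (C (b i)) y < ε / 2 := by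
    intro i _
    have := hcov ⟨b i, by simp [hb1], rfl⟩
    simpa using this
  choose! y hyt hyd using hmem
  obtain ⟨i, hi, j, hj, hij, hy⟩ :=
    Set.Infinite.exists_ne_map_eq_of_mapsTo (f := y) hinf hyt ht
  have hd : dist (C (b i)) (C (b j)) < ε := by
    have h1 := hyd i hi
    have h2 := hyd j hj
    rw [← hy, dist_comm] at h2
    linarith [dist_triangle (C (b i)) (y i) (C (b j))]
  have horth : ∀ i ∈ {i | ε ≤ (ρ i).re ∧ (ρ i).re < 1}, C (b i) = ((ρ i).re : ℂ) • b i := by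
    intro i hi
    rw [hCorth i, hr]
    refine (hcases i).resolve_left fun h => hi.2.ne ?_
    have h1 := hR.apply_eq_self_iff.2 h
    rw [hr] at h1
    have h2 := congrArg (fun x => ⟪b i, x⟫_ℂ) h1
    simp only [inner_smul_right, inner_self_eq_norm_sq_to_K, hb1] at h2
    exact_mod_cast (by simpa using h2 : ((ρ i).re : ℂ) = 1)
  have hin : ⟪b i, C (b i) - C (b j)⟫_ℂ = (ρ i).re := by
    rw [horth i hi, horth j hj, inner_sub_right, inner_smul_right, inner_smul_right,
      b.orthonormal.2 hij, inner_self_eq_norm_sq_to_K, hb1]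
    simp
  have hle := norm_inner_le_norm (𝕜 := ℂ) (b i) (C (b i) - C (b j))
  rw [hin, hb1, one_mul, ← dist_eq_norm, Complex.norm_real, Real.norm_eq_abs] at hle
  linarith [le_abs_self (ρ i).re, hi.1]

/-! ### Singular values of diagonal operators. -/

section SingularValues

variable {H : Type*} [NormedAddCommGroup H] [InnerProductSpace ℂ H] [CompleteSpace H]
  {ι : Type*} {b : HilbertBasis ι ℂ H} {T : H →L[ℂ] H} {t : ι → ℝ}

/-- The diagonal operator with entries `t i` for `i ∈ s` and `0` elsewhere. -/
noncomputable def diagonalOn (b : HilbertBasis ι ℂ H) (t : ι → ℝ) (s : Finset ι) : H →L[ℂ] H :=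
  ∑ i ∈ s, (t i : ℂ) • (innerSL ℂ (b i)).smulRight (b i)

theorem diagonalOn_apply (s : Finset ι) (x : H) :
    diagonalOn b t s x = ∑ i ∈ s, (t i : ℂ) • ⟪b i, x⟫_ℂ • b i := by
  simp [diagonalOn]

theorem range_diagonalOn_le (s : Finset ι) :
    LinearMap.range (diagonalOn b t s : H →ₗ[ℂ] H) ≤ Submodule.span ℂ (b '' (s : Set ι)) := by
  rintro _ ⟨x, rfl⟩
  change diagonalOn b t s x ∈ _
  rw [diagonalOn_apply]
  exact Submodule.sum_mem _ fun i hi => Submodule.smul_mem _ _ (Submodule.smul_mem _ _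
    (Submodule.subset_span ⟨i, hi, rfl⟩))

theorem rank_diagonalOn_le (s : Finset ι) :
    (diagonalOn b t s : H →ₗ[ℂ] H).rank ≤ s.card := by
  classical
  refine (Submodule.rank_mono (range_diagonalOn_le s)).trans ?_
  rw [← Finset.coe_image]
  exact (rank_span_finset_le _).trans (by exact_mod_cast Finset.card_image_le)

theorem isCompactOperator_diagonalOn (s : Finset ι) : IsCompactOperator (diagonalOn b t s) := by
  have hfd : FiniteDimensional ℂ (Submodule.span ℂ (b '' (s : Set ι))) :=
    FiniteDimensional.span_of_finite ℂ (s.finite_toSet.image b)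
  let G : H →L[ℂ] Submodule.span ℂ (b '' (s : Set ι)) :=
    (diagonalOn b t s).codRestrict _ fun x => range_diagonalOn_le s ⟨x, rfl⟩
  have hG : IsCompactOperator G := by
    refine ⟨Metric.closedBall 0 ‖G‖, isCompact_closedBall _ _, ?_⟩
    refine mem_of_superset (Metric.ball_mem_nhds 0 one_pos) fun x hx => ?_
    rw [mem_preimage, mem_closedBall_zero_iff]
    refine (G.le_opNorm x).trans ?_
    rw [mem_ball_zero_iff] at hx
    nlinarith [norm_nonneg G]
  exact hG.clm_comp (Submodule.span ℂ (b '' (s : Set ι))).subtypeL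

theorem norm_sub_diagonalOn_le (hT : ∀ x y, ⟪T x, y⟫_ℂ = ⟪x, T y⟫_ℂ)
    (ht : ∀ i, T (b i) = (t i : ℂ) • b i) {s : Finset ι} {C : ℝ} (hC : 0 ≤ C)
    (h : ∀ i ∉ s, |t i| ≤ C) : ‖T - diagonalOn b t s‖ ≤ C := by
  classical
  refine ContinuousLinearMap.opNorm_le_bound _ hC fun x => ?_
  refine norm_le_of_norm_inner_le b hC fun j => ?_
  have h1 : ⟪b j, (T - diagonalOn b t s) x⟫_ℂ =
      ((if j ∈ s then 0 else t j : ℝ) : ℂ) * ⟪b j, x⟫_ℂ := by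
    rw [_root_.sub_apply, inner_sub_right, inner_apply_of_diagonal hT ht,
      diagonalOn_apply, inner_sum]
    simp only [inner_smul_right, orthonormal_iff_ite.1 b.orthonormal, mul_ite, mul_one, mul_zero,
      Finset.sum_ite_eq]
    split_ifs <;> simp
  rw [h1, norm_mul, Complex.norm_real, Real.norm_eq_abs]
  refine mul_le_mul_of_nonneg_right ?_ (norm_nonneg _)
  split_ifs with hj
  · simpa using hC
  · exact h j hj

/-- The truncation of `T` to `s` has rank less than `n`, and the remaining entries bound the norm of
the difference. -/
theorem singularValue_le_of_diagonal (hT : ∀ x y, ⟪T x, y⟫_ℂ = ⟪x, T y⟫_ℂ)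
    (ht : ∀ i, T (b i) = (t i : ℂ) • b i) {s : Finset ι} {n : ℕ} (hs : s.card < n) {C : ℝ}
    (hC : 0 ≤ C) (h : ∀ i ∉ s, |t i| ≤ C) : singularValue T n ≤ C := by
  have hbdd : BddBelow {r : ℝ | ∃ F : H →L[ℂ] H, (F : H →ₗ[ℂ] H).rank < n ∧ r = ‖T - F‖} := by
    refine ⟨0, ?_⟩
    rintro _ ⟨F, -, rfl⟩
    exact norm_nonneg _
  refine (csInf_le hbdd ⟨diagonalOn b t s, ?_, rfl⟩).trans
    (norm_sub_diagonalOn_le hT ht hC h)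
  · exact (rank_diagonalOn_le s).trans_lt (by exact_mod_cast hs)

/-- An `F` of rank less than `n` kills a nonzero vector `x` in the span of the `b i`, `i ∈ s`, by
dimension count. There `‖(T - F) x‖ = ‖T x‖ ≥ C * ‖x‖`. -/
theorem le_singularValue_of_diagonal (hT : ∀ x y, ⟪T x, y⟫_ℂ = ⟪x, T y⟫_ℂ)
    (ht : ∀ i, T (b i) = (t i : ℂ) • b i) {s : Finset ι} {n : ℕ} (hn : 0 < n) (hs : n ≤ s.card)
    {C : ℝ} (hC : 0 < C) (h : ∀ i ∈ s, C ≤ |t i|) : C ≤ singularValue T n := by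
  classical
  refine le_csInf ⟨‖T - 0‖, 0, ?_, rfl⟩ ?_
  · have : ((0 : H →L[ℂ] H) : H →ₗ[ℂ] H).rank = 0 := by
      rw [ContinuousLinearMap.toLinearMap_zero, LinearMap.rank, LinearMap.range_zero, rank_bot]
    rw [this]
    exact_mod_cast hn
  rintro _ ⟨F, hF, rfl⟩
  let v : s → H := fun i => b i
  have hv : LinearIndependent ℂ v :=
    b.orthonormal.linearIndependent.comp _ Subtype.val_injective
  set V := Submodule.span ℂ (range v) with hV
  have hfin : Module.finrank ℂ V = s.card := by
    rw [hV, finrank_span_eq_card hv, Fintype.card_coe]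
  have : FiniteDimensional ℂ V := FiniteDimensional.span_of_finite ℂ (finite_range v)
  obtain ⟨x, hx, hx0, hFx⟩ : ∃ x ∈ V, x ≠ 0 ∧ F x = 0 := by
    by_contra! hcon
    set G : V →ₗ[ℂ] H := (F : H →ₗ[ℂ] H).domRestrict V with hG
    have hker : LinearMap.ker G = ⊥ := by
      rw [LinearMap.ker_eq_bot']
      intro x hx
      by_contra hx0
      exact hcon x x.2 (by simpa using hx0) hx
    have h1 := LinearMap.rank_range_add_rank_ker G
    rw [hker, rank_bot, add_zero, ← Module.finrank_eq_rank ℂ V, hfin] at h1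
    have h2 : Module.rank ℂ (LinearMap.range G) ≤ (F : H →ₗ[ℂ] H).rank := by
      refine Submodule.rank_mono ?_
      rintro _ ⟨x, rfl⟩
      exact ⟨x, rfl⟩
    rw [h1] at h2
    have h3 := h2.trans_lt hF
    exact absurd hs (not_le.2 (by exact_mod_cast h3))
  have hout : ∀ i ∉ s, ⟪b i, x⟫_ℂ = 0 := by
    intro i hi
    have : V ≤ (ℂ ∙ b i)ᗮ := by
      rw [hV, Submodule.span_le]
      rintro _ ⟨j, rfl⟩
      rw [SetLike.mem_coe, Submodule.mem_orthogonal_singleton_iff_inner_right]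
      exact b.orthonormal.2 fun hij => hi (hij ▸ j.2)
    exact Submodule.mem_orthogonal_singleton_iff_inner_right.1 (this hx)
  have hle : ‖x‖ ≤ C⁻¹ * ‖T x‖ := by
    refine norm_le_of_norm_inner_le b (by positivity) fun i => ?_
    by_cases hi : i ∈ s
    · rw [inner_apply_of_diagonal hT ht, norm_mul, Complex.norm_real, Real.norm_eq_abs,
        inv_mul_eq_div, le_div_iff₀ hC, mul_comm]
      exact mul_le_mul_of_nonneg_right (h i hi) (norm_nonneg _)
    · rw [hout i hi, norm_zero]
      positivity
  rw [inv_mul_eq_div, le_div_iff₀ hC] at hle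
  have hop := (T - F).le_opNorm x
  rw [_root_.sub_apply, hFx, sub_zero] at hop
  have hxp : 0 < ‖x‖ := norm_pos_iff.2 hx0
  refine le_of_mul_le_mul_right ?_ hxp
  linarith

end SingularValues

/-! ### Functions of `L` and their traces in an eigenbasis. -/

/-- A Hilbert basis of eigenvectors of `L`, in terms of the eigenvalues `resolventValue i` of
`(1 + L)⁻¹`, with discreteness of the spectrum of `L` off its kernel. -/
structure Eigenbasis {H : Type*} [NormedAddCommGroup H] [InnerProductSpace ℂ H] [CompleteSpace H]
    (L : H →ₗ.[ℂ] H) (ι : Type*) where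
  basis : HilbertBasis ι ℂ H
  resolventValue : ι → ℝ
  pos : ∀ i, 0 < resolventValue i
  le_one : ∀ i, resolventValue i ≤ 1
  apply_basis : ∀ i, resolvent L (basis i) = (resolventValue i : ℂ) • basis i
  finite : ∀ ε : ℝ, 0 < ε → {i | ε ≤ resolventValue i ∧ resolventValue i < 1}.Finite
  isSelfAdjoint : IsSelfAdjoint (resolvent L)

namespace Eigenbasis

variable {H : Type*} [NormedAddCommGroup H] [InnerProductSpace ℂ H] [CompleteSpace H]
  {L : H →ₗ.[ℂ] H} {ι : Type*} (B : Eigenbasis L ι)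

/-- The eigenvalues of `L`. -/
noncomputable def eigenvalue (i : ι) : ℝ := (B.resolventValue i)⁻¹ - 1

/-- The indices of the nonzero eigenvalues of `L`. -/
abbrev Index : Type _ := ({i | B.resolventValue i < 1} : Set ι)

theorem eigenvalue_pos (j : B.Index) : 0 < B.eigenvalue j :=
  sub_pos.2 ((one_lt_inv₀ (B.pos j)).2 j.2)

theorem finite_eigenvalue_le (x : ℝ) : {j : B.Index | B.eigenvalue j ≤ x}.Finite := by
  rcases le_or_gt x 0 with hx | hx
  · convert finite_empty
    ext j
    simp only [mem_ofPred_eq, mem_empty_iff_false, iff_false, not_le]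
    exact hx.trans_lt (B.eigenvalue_pos j)
  · refine Set.Finite.of_finite_image ((B.finite (1 + x)⁻¹ (by positivity)).subset ?_)
      Subtype.val_injective.injOn
    rintro _ ⟨j, hj, rfl⟩
    refine ⟨?_, j.2⟩
    rw [inv_le_comm₀ (by positivity) (B.pos j)]
    have : (B.resolventValue j)⁻¹ - 1 ≤ x := hj
    linarith

/-- The spectrum lies in the closure of the resolvent eigenvalues, which accumulate at `0` only.
Near a point `z > 0` that closure is finite, so any `g` is continuous there; at `0` the hypotheses
give continuity. This lets discontinuous functions, such as indicators, enter the functional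
calculus. -/
theorem continuousOn_spectrum (B : Eigenbasis L ι) {g : ℝ → ℝ} (h0 : g 0 = 0) (hg : Tendsto g (𝓝[>] 0) (𝓝 0)) :
    ContinuousOn g (spectrum ℝ (resolvent L)) := by
  have hsub := spectrum_subset_closure_range
    (ContinuousLinearMap.isSelfAdjoint_iff_isSymmetric.1 B.isSelfAdjoint) B.apply_basis
  refine ContinuousOn.mono (fun z hz => ?_) hsub
  have hz0 : 0 ≤ z := by
    have : closure (range B.resolventValue) ⊆ Ici 0 :=
      closure_minimal (by rintro _ ⟨i, rfl⟩; exact (B.pos i).le) isClosed_Ici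
    exact this hz
  rcases hz0.eq_or_lt with rfl | hz0
  · have : closure (range B.resolventValue) ⊆ Ici 0 :=
      closure_minimal (by rintro _ ⟨i, rfl⟩; exact (B.pos i).le) isClosed_Ici
    refine ContinuousWithinAt.mono ?_ this
    rw [← Ioi_insert, continuousWithinAt_insert_self, ContinuousWithinAt, h0]
    exact hg
  · have hU : Ioi (z / 2) ∈ 𝓝 z := Ioi_mem_nhds (by linarith)
    rw [← continuousWithinAt_inter hU]
    have hfin : (range B.resolventValue ∩ Ioi (z / 2)).Finite := by
      refine (((B.finite (z / 2) (by positivity)).image B.resolventValue).union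
        (finite_singleton (1 : ℝ))).subset ?_
      rintro _ ⟨⟨i, rfl⟩, hi⟩
      rcases (B.le_one i).lt_or_eq with h | h
      · exact Or.inl ⟨i, ⟨le_of_lt hi, h⟩, rfl⟩
      · exact Or.inr h
    have hsub : closure (range B.resolventValue) ∩ Ioi (z / 2) ⊆
        range B.resolventValue ∩ Ioi (z / 2) := by
      rw [← hfin.isClosed.closure_eq]
      exact isOpen_Ioi.closure_inter
    exact ((hfin.subset hsub).continuousOn g) z ⟨hz, by simp only [mem_Ioi]; linarith⟩

theorem cfc_apply_basis {g : ℝ → ℝ} (h0 : g 0 = 0) (hg : Tendsto g (𝓝[>] 0) (𝓝 0)) (i : ι) :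
    cfc g (resolvent L) (B.basis i) = (g (B.resolventValue i) : ℂ) • B.basis i :=
  cfc_apply_eigenvector B.isSelfAdjoint (B.basis.orthonormal.ne_zero i) (B.apply_basis i)
    (B.continuousOn_spectrum h0 hg)

theorem trace_cfc {g : ℝ → ℝ} (hnn : ∀ x, 0 ≤ g x) (h0 : g 0 = 0)
    (hg : Tendsto g (𝓝[>] 0) (𝓝 0)) :
    trace (cfc g (resolvent L)) = ∑' i, ENNReal.ofReal (g (B.resolventValue i)) := by
  have hpos : (cfc g (resolvent L)).IsPositive :=
    (ContinuousLinearMap.nonneg_iff_isPositive _).1 (cfc_nonneg fun x _ => hnn x)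
  rw [trace_eq_traceAlong B.basis hpos, traceAlong]
  refine tsum_congr fun i => ?_
  rw [B.cfc_apply_basis h0 hg, inner_smul_right, inner_self_eq_norm_sq_to_K,
    B.basis.orthonormal.1 i]
  simp

theorem tendsto_transported {f : ℝ → ℝ} (hf : Tendsto f atTop (𝓝 0)) :
    Tendsto (fun r : ℝ => if 0 < r ∧ r < 1 then f (r⁻¹ - 1) else 0) (𝓝[>] 0) (𝓝 0) := by
  have h1 : Tendsto (fun r : ℝ => f (r⁻¹ - 1)) (𝓝[>] 0) (𝓝 0) :=
    hf.comp (tendsto_atTop_add_const_right _ (-1) tendsto_inv_nhdsGT_zero)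
  refine h1.congr' ?_
  filter_upwards [Ioo_mem_nhdsGT (zero_lt_one (α := ℝ))] with r hr
  rw [if_pos ⟨hr.1, hr.2⟩]

theorem functionOf_apply_basis {f : ℝ → ℝ} (hf : Tendsto f atTop (𝓝 0)) (i : ι) :
    functionOf L f (B.basis i) =
      ((if B.resolventValue i < 1 then f (B.eigenvalue i) else 0 : ℝ) : ℂ) • B.basis i := by
  rw [functionOf, B.cfc_apply_basis (by simp) (tendsto_transported hf)]
  simp [B.pos i, eigenvalue]

theorem trace_functionOf {f : ℝ → ℝ} (hnn : ∀ x, 0 ≤ f x) (hf : Tendsto f atTop (𝓝 0)) :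
    trace (functionOf L f) = ∑' j : B.Index, ENNReal.ofReal (f (B.eigenvalue j)) := by
  rw [functionOf, B.trace_cfc (fun x => by split_ifs <;> simp [hnn]) (by simp)
    (tendsto_transported hf)]
  rw [tsum_subtype {i | B.resolventValue i < 1} fun i => ENNReal.ofReal (f (B.eigenvalue i))]
  refine tsum_congr fun i => ?_
  by_cases h : B.resolventValue i < 1 <;> simp [indicator, B.pos i, h, eigenvalue]

theorem countingFunction_eq (x : ℝ) :
    countingFunction L x = ({j : B.Index | B.eigenvalue j ≤ x}.ncard : ℝ) := by
  have hf : Tendsto ((Ioc 0 x).indicator (1 : ℝ → ℝ)) atTop (𝓝 0) := by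
    refine tendsto_const_nhds.congr' ?_
    filter_upwards [eventually_gt_atTop x] with y hy
    rw [indicator_of_notMem fun h => absurd h.2 (not_le.2 hy)]
  have h1 : ∀ j : B.Index, ENNReal.ofReal ((Ioc 0 x).indicator (1 : ℝ → ℝ) (B.eigenvalue j)) =
      {j : B.Index | B.eigenvalue j ≤ x}.indicator 1 j := by
    intro j
    by_cases h : B.eigenvalue j ≤ x <;> simp [indicator, B.eigenvalue_pos j, h]
  rw [countingFunction, spectralProjection,
    B.trace_functionOf (f := (Ioc 0 x).indicator 1) (indicator_nonneg fun _ _ => zero_le_one) hf]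
  simp_rw [h1]
  rw [← tsum_subtype {j : B.Index | B.eigenvalue j ≤ x} 1]
  have := (B.finite_eigenvalue_le x).fintype
  rw [tsum_fintype]
  simp

theorem tendsto_exp_neg {t : ℝ} (ht : 0 < t) :
    Tendsto (fun x => Real.exp (-t * x)) atTop (𝓝 0) :=
  Real.tendsto_exp_atBot.comp (tendsto_id.const_mul_atTop_of_neg (by linarith))

theorem trace_heatSemigroupOffKernel {t : ℝ} (ht : 0 < t) :
    trace (heatSemigroupOffKernel L t) =
      ∑' j : B.Index, ENNReal.ofReal (Real.exp (-t * B.eigenvalue j)) :=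
  B.trace_functionOf (fun _ => (Real.exp_pos _).le) (tendsto_exp_neg ht)

/-- Basis vectors with resolvent eigenvalue `1` lie in the kernel and contribute `1` each, so the
second sum does not depend on `t`. -/
theorem trace_heatSemigroup {t : ℝ} (ht : 0 < t) :
    trace (heatSemigroup L t) =
      ∑' j : B.Index, ENNReal.ofReal (Real.exp (-t * B.eigenvalue j)) +
        ∑' _ : ({i | B.resolventValue i < 1}ᶜ : Set ι), 1 := by
  have hlim : Tendsto (fun r : ℝ => if 0 < r then Real.exp (-t * (r⁻¹ - 1)) else 0)
      (𝓝[>] 0) (𝓝 0) := by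
    have h1 := (tendsto_exp_neg ht).comp
      (tendsto_atTop_add_const_right _ (-1) (tendsto_inv_nhdsGT_zero (𝕜 := ℝ)))
    refine h1.congr' ?_
    filter_upwards [self_mem_nhdsWithin] with r hr
    rw [if_pos (mem_Ioi.1 hr)]
    rfl
  rw [heatSemigroup, B.trace_cfc (fun x => by split_ifs <;> positivity) (by simp) hlim,
    ← ENNReal.summable.tsum_add_tsum_compl (s := {i | B.resolventValue i < 1}) ENNReal.summable]
  congr 1
  · refine tsum_congr fun j => ?_
    rw [if_pos (B.pos j)]
    rfl
  · refine tsum_congr fun j => ?_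
    have h : B.resolventValue j = 1 := le_antisymm (B.le_one j) (not_lt.1 j.2)
    rw [if_pos (B.pos j), h]
    simp

/-- Pair `R (x + L x) = x` with the eigenvector `B.basis i` of the symmetric operator `R`, and solve
for the coefficient of `L x`. -/
theorem eigenvalue_mul_inner {R : H →L[ℂ] H} (hR : R = resolvent L) (hres : IsResolvent L R)
    (x : L.domain) (i : ι) : ⟪B.basis i, L x⟫_ℂ = B.eigenvalue i * ⟪B.basis i, (x : H)⟫_ℂ := by
  have h1 : R (x + L x) = x := by
    rw [hres, add_sub_cancel_left]
    exact L.mem_graph x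
  have h2 := inner_apply_of_diagonal
    (ContinuousLinearMap.isSelfAdjoint_iff_isSymmetric.1 B.isSelfAdjoint) B.apply_basis i (x + L x)
  rw [← hR, h1, inner_add_right] at h2
  have h3 : (B.resolventValue i : ℂ) ≠ 0 := by exact_mod_cast (B.pos i).ne'
  rw [eigenvalue]
  push_cast
  field_simp
  linear_combination -h2

/-- With finitely many nonzero eigenvalues, their maximum would bound `L` coordinatewise. -/
theorem infinite_index (hself : IsSelfAdjoint L) (hnonneg : IsNonnegOp L)
    (hunb : IsUnboundedOp L) : Infinite B.Index := by
  by_contra hfin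
  rw [not_infinite_iff_finite] at hfin
  obtain ⟨C, hC⟩ := (Set.finite_range fun j : B.Index => B.eigenvalue j).bddAbove
  obtain ⟨x, hx⟩ := hunb (max C 0)
  refine absurd hx (not_lt.2 (norm_le_of_norm_inner_le B.basis (le_max_right _ _) fun i => ?_))
  rw [B.eigenvalue_mul_inner rfl (isResolvent_resolvent hself hnonneg), norm_mul,
    Complex.norm_real, Real.norm_eq_abs]
  refine mul_le_mul_of_nonneg_right ?_ (norm_nonneg _)
  rcases (B.le_one i).lt_or_eq with h | h
  · rw [abs_of_pos (B.eigenvalue_pos ⟨i, h⟩)]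
    exact (hC ⟨⟨i, h⟩, rfl⟩).trans (le_max_left _ _)
  · simp [eigenvalue, h]

end Eigenbasis

/-! ### Index of regular variation, the limit measure, and polynomial approximation. -/

/-- A monotone additive function on `ℝ` is linear. -/
theorem additive_monotone_eq_mul {φ : ℝ → ℝ} (hadd : ∀ s t, φ (s + t) = φ s + φ t)
    (hmono : Monotone φ) (t : ℝ) : φ t = t * φ 1 := by
  let F : ℝ →+ ℝ := AddMonoidHom.mk' φ hadd
  have hc : Continuous F := MeasureTheory.Measure.AddMonoidHom.continuous_of_measurable F hmono.measurable
  have h := map_real_smul F hc t 1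
  rw [smul_eq_mul, mul_one, smul_eq_mul] at h
  exact h

theorem tendsto_const_mul_nhdsGT_zero {s : ℝ} (hs : 0 < s) :
    Tendsto (fun β : ℝ => s * β) (𝓝[>] 0) (𝓝[>] 0) := by
  refine tendsto_nhdsWithin_iff.2 ⟨?_, ?_⟩
  · have : Tendsto (fun β : ℝ => s * β) (𝓝 0) (𝓝 (s * 0)) := tendsto_id.const_mul s
    rw [mul_zero] at this
    exact this.mono_left nhdsWithin_le_nhds
  · filter_upwards [self_mem_nhdsWithin] with β hβ
    exact mul_pos hs (mem_Ioi.1 hβ)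

/-- An antitone positive function which is regularly varying at `0⁺` has a nonpositive index. -/
theorem exists_index_of_regularlyVarying {W : ℝ → ℝ} (hpos : ∀ β, 0 < β → 0 < W β)
    (hanti : AntitoneOn W (Ioi 0))
    (hreg : ∀ s, 0 < s → ∃ k, 0 < k ∧ Tendsto (fun β => W (s * β) / W β) (𝓝[>] 0) (𝓝 k)) :
    ∃ d : ℝ, 0 ≤ d ∧ ∀ s, 0 < s →
      Tendsto (fun β => W (s * β) / W β) (𝓝[>] 0) (𝓝 (s ^ (-d))) := by
  choose! k hk0 hk using hreg
  have hmul : ∀ s t : ℝ, 0 < s → 0 < t → k (s * t) = k s * k t := by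
    intro s t hs ht
    have h1 := ((hk s hs).comp (tendsto_const_mul_nhdsGT_zero ht)).mul (hk t ht)
    refine tendsto_nhds_unique (hk (s * t) (mul_pos hs ht)) (h1.congr' ?_)
    filter_upwards [self_mem_nhdsWithin] with β hβ
    have := hpos (t * β) (mul_pos ht hβ)
    simp only [Function.comp_apply]
    rw [mul_assoc]
    field_simp
  have hkanti : ∀ s t : ℝ, 0 < s → s ≤ t → k t ≤ k s := by
    intro s t hs hst
    refine le_of_tendsto_of_tendsto (hk t (hs.trans_le hst)) (hk s hs) ?_
    filter_upwards [self_mem_nhdsWithin] with β hβ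
    have hβ' : 0 < β := hβ
    refine div_le_div_of_nonneg_right (hanti (mul_pos hs hβ) (mul_pos (hs.trans_le hst) hβ) ?_)
      (hpos β hβ).le
    gcongr
  -- The limit ratio `k` is multiplicative and antitone, so in logarithmic coordinates it becomes
  -- additive and monotone, hence linear with slope `d = φ 1`.
  set φ : ℝ → ℝ := fun t => -Real.log (k (Real.exp t)) with hφ
  have hadd : ∀ s t, φ (s + t) = φ s + φ t := by
    intro s t
    simp only [hφ]
    rw [Real.exp_add, hmul _ _ (Real.exp_pos s) (Real.exp_pos t),
      Real.log_mul (hk0 _ (Real.exp_pos _)).ne' (hk0 _ (Real.exp_pos _)).ne']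
    ring
  have hmono : Monotone φ := by
    intro s t hst
    refine neg_le_neg (Real.log_le_log (hk0 _ (Real.exp_pos _)) ?_)
    exact hkanti _ _ (Real.exp_pos _) (Real.exp_le_exp.2 hst)
  have h0 : φ 0 = 0 := by have := hadd 0 0; simp at this; exact this
  refine ⟨φ 1, h0 ▸ hmono zero_le_one, fun s hs => ?_⟩
  have h1 := additive_monotone_eq_mul hadd hmono (Real.log s)
  have h2 : k s = s ^ (-φ 1) := by
    rw [Real.rpow_def_of_pos hs, mul_neg, ← h1]
    simp only [hφ, Real.exp_log hs, neg_neg]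
    rw [Real.exp_log (hk0 s hs)]
  rw [← h2]
  exact hk s hs

/-- The probability measure on `[0, 1]` with moments `(m + 1) ^ (-d)`. -/
theorem exists_measure_moments {d : ℝ} (hd : 0 ≤ d) : ∃ ν : Measure ℝ, IsProbabilityMeasure ν ∧
    (∀ᵐ u ∂ν, u ∈ Icc (0 : ℝ) 1) ∧ ν {Real.exp (-1)} = 0 ∧ 0 < ν (Ici (Real.exp (-1))) ∧
    ∀ m : ℕ, ∫ u, u ^ m ∂ν = ((m : ℝ) + 1) ^ (-d) := by
  -- For `d = 0` all moments are `1`, which is the Dirac mass at `1`.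
  rcases hd.eq_or_lt with rfl | hd
  · refine ⟨Measure.dirac 1, inferInstance, ?_, ?_, ?_, ?_⟩
    · rw [ae_dirac_eq]
      exact ⟨zero_le_one, le_rfl⟩
    · rw [Measure.dirac_apply' _ (measurableSet_singleton _), indicator_of_notMem]
      simp only [mem_singleton_iff]
      exact (by simp : Real.exp (-1) < 1).ne'
    · rw [Measure.dirac_apply' _ measurableSet_Ici, indicator_of_mem]
      · simp
      · exact (by simp : Real.exp (-1) < 1).le
    · intro m
      simp
  -- For `d > 0` the measure is the law of `exp (-X)` with `X` gamma distributed of shape `d` and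
  -- rate `1`; its moments are the Laplace transform of `X` at the integers.
  set γ := ProbabilityTheory.gammaMeasure d 1 with hγ
  have hprob : IsProbabilityMeasure γ :=
    ProbabilityTheory.isProbabilityMeasure_gammaMeasure hd one_pos
  have hmeas : Measurable fun x : ℝ => Real.exp (-x) := by fun_prop
  have hpdf : Measurable (ProbabilityTheory.gammaPDF d 1) := by
    unfold ProbabilityTheory.gammaPDF
    exact (ProbabilityTheory.measurable_gammaPDFReal d 1).ennreal_ofReal
  have hac : γ ≪ volume := withDensity_absolutelyContinuous _ _
  have hneg : ∀ᵐ x ∂γ, 0 ≤ x := by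
    rw [hγ, ProbabilityTheory.gammaMeasure, ae_withDensity_iff hpdf]
    refine ae_of_all _ fun x hx => ?_
    by_contra h
    exact hx (ProbabilityTheory.gammaPDF_of_neg (not_le.1 h))
  refine ⟨γ.map fun x => Real.exp (-x), Measure.isProbabilityMeasure_map hmeas.aemeasurable,
    ?_, ?_, ?_, ?_⟩
  · refine (ae_map_iff hmeas.aemeasurable (p := (· ∈ Icc (0 : ℝ) 1)) measurableSet_Icc).2 ?_
    filter_upwards [hneg] with x hx
    exact ⟨(Real.exp_pos _).le, Real.exp_le_one_iff.2 (by linarith)⟩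
  · rw [Measure.map_apply hmeas (measurableSet_singleton _)]
    have : (fun x : ℝ => Real.exp (-x)) ⁻¹' {Real.exp (-1)} = {1} := by
      ext x
      simp [Real.exp_eq_exp]
    rw [this]
    exact hac (by simp)
  · rw [Measure.map_apply hmeas measurableSet_Ici]
    have : (fun x : ℝ => Real.exp (-x)) ⁻¹' Ici (Real.exp (-1)) = Iic 1 := by
      ext x
      simp
    rw [this, pos_iff_ne_zero]
    intro h0
    rw [hγ, ProbabilityTheory.gammaMeasure, withDensity_apply_eq_zero hpdf] at h0
    have hsub : Ioc (0 : ℝ) 1 ⊆ {x | ProbabilityTheory.gammaPDF d 1 x ≠ 0} ∩ Iic 1 := by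
      intro x hx
      refine ⟨?_, hx.2⟩
      change ProbabilityTheory.gammaPDF d 1 x ≠ 0
      rw [ProbabilityTheory.gammaPDF_of_nonneg hx.1.le, ne_eq, ENNReal.ofReal_eq_zero, not_le]
      have := Real.Gamma_pos_of_pos hd
      have := Real.rpow_pos_of_pos hx.1 (d - 1)
      positivity
    have := measure_mono_null hsub h0
    simp at this
  · intro m
    rw [integral_map hmeas.aemeasurable (by fun_prop), hγ, ProbabilityTheory.gammaMeasure,
      integral_withDensity_eq_integral_toReal_smul hpdf
        (ae_of_all _ fun x => ENNReal.ofReal_lt_top)]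
    have hint : ∀ x : ℝ, (ProbabilityTheory.gammaPDF d 1 x).toReal • Real.exp (-x) ^ m =
        (Ici 0).indicator (fun x => (Real.Gamma d)⁻¹ *
          (x ^ (d - 1) * Real.exp (-((m + 1 : ℝ) * x)))) x := by
      intro x
      by_cases hx : 0 ≤ x
      · have := Real.Gamma_pos_of_pos hd
        rw [ProbabilityTheory.gammaPDF_of_nonneg hx, ENNReal.toReal_ofReal (by positivity),
          indicator_of_mem (mem_Ici.2 hx), smul_eq_mul, ← Real.exp_nat_mul, Real.one_rpow,
          one_div, mul_assoc, mul_assoc, ← Real.exp_add]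
        congr 4
        ring
      · rw [ProbabilityTheory.gammaPDF_of_neg (not_le.1 hx), indicator_of_notMem (mt mem_Ici.1 hx)]
        simp
    simp_rw [hint]
    rw [integral_indicator measurableSet_Ici, integral_Ici_eq_integral_Ioi, integral_const_mul,
      Real.integral_rpow_mul_exp_neg_mul_Ioi hd (by positivity), one_div,
      Real.inv_rpow (by positivity), Real.rpow_neg (by positivity)]
    have := Real.Gamma_pos_of_pos hd
    field_simp

/-- The function `u⁻¹` cut off below `a`. -/
noncomputable def invAbove (a u : ℝ) : ℝ := if a ≤ u then u⁻¹ else 0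

theorem integrable_of_continuous_of_mem_Icc {ν : Measure ℝ} [IsFiniteMeasure ν]
    (hν : ∀ᵐ u ∂ν, u ∈ Icc (0 : ℝ) 1) {f : ℝ → ℝ} (hf : Continuous f) : Integrable f ν := by
  have h := hf.continuousOn.integrableOn_Icc (μ := ν) (a := 0) (b := 1)
  rwa [IntegrableOn, Measure.restrict_eq_self_of_ae_mem hν] at h

theorem integrable_invAbove {ν : Measure ℝ} [IsFiniteMeasure ν] {a : ℝ} (ha : 0 < a) :
    Integrable (invAbove a) ν := by
  refine Integrable.of_bound (C := a⁻¹) ?_ (ae_of_all _ fun u => ?_)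
  · exact (Measurable.ite measurableSet_Ici measurable_inv measurable_const).aestronglyMeasurable
  · rw [invAbove]
    split_ifs with h
    · rw [norm_inv, Real.norm_eq_abs, abs_of_pos (ha.trans_le h)]
      exact inv_anti₀ ha h
    · simp [ha.le]

/-- One-sided polynomial approximation of the truncated inverse. -/
theorem exists_polynomial_sandwich {ν : Measure ℝ} [IsProbabilityMeasure ν]
    (hν : ∀ᵐ u ∂ν, u ∈ Icc (0 : ℝ) 1) {a : ℝ} (ha : 0 < a) (hνa : ν {a} = 0) {ε : ℝ}
    (hε : 0 < ε) :
    ∃ p q : Polynomial ℝ, (∀ u ∈ Icc (0 : ℝ) 1, p.eval u ≤ invAbove a u) ∧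
      (∀ u ∈ Icc (0 : ℝ) 1, invAbove a u ≤ q.eval u) ∧
      ∫ u, q.eval u ∂ν - ∫ u, p.eval u ∂ν < ε := by
  -- As the jump at `a` is not charged, a small ball around it has small mass. The factor `a`
  -- offsets the bound `a⁻¹` for the gap between the continuous approximants on that ball.
  obtain ⟨δ, hδ0, hδ⟩ : ∃ δ > 0, ν.real (Metric.closedBall a δ) < a * (ε / 2) := by
    have h1 := tendsto_measure_cthickening_of_isCompact (μ := ν) (isCompact_singleton (x := a))
    rw [hνa] at h1
    have h2 : ∀ᶠ δ in 𝓝[>] (0 : ℝ), ν (Metric.cthickening δ {a}) < ENNReal.ofReal (a * (ε / 2)) :=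
      (h1.mono_left nhdsWithin_le_nhds).eventually_lt_const
        (ENNReal.ofReal_pos.2 (by positivity))
    obtain ⟨δ, h3, h4⟩ := (h2.and self_mem_nhdsWithin).exists
    have h4' : 0 < δ := h4
    refine ⟨δ, h4', ?_⟩
    rw [Metric.cthickening_singleton _ h4'.le] at h3
    rw [measureReal_def]
    exact (ENNReal.lt_ofReal_iff_toReal_lt (measure_ne_top _ _)).1 h3
  set ramp : ℝ → ℝ := fun u => min 1 (max 0 u) with hramp
  have hrc : Continuous ramp := by fun_prop
  have hr0 : ∀ u, 0 ≤ ramp u := fun u => le_min zero_le_one (le_max_left _ _)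
  have hr1 : ∀ u, ramp u ≤ 1 := fun u => min_le_left _ _
  have hrneg : ∀ u ≤ 0, ramp u = 0 := fun u hu => by simp [hramp, max_eq_left hu]
  have hrone : ∀ u, 1 ≤ u → ramp u = 1 := fun u hu => by
    simp only [hramp]
    rw [max_eq_right (by linarith), min_eq_left hu]
  have hma : ∀ u, 0 < max u a := fun u => lt_max_of_lt_right ha
  set h : ℝ → ℝ := fun u => (max u a)⁻¹ with hh
  have hh0 : ∀ u, 0 < h u := fun u => inv_pos.2 (hma u)
  have hhc : Continuous h := (continuous_id.max continuous_const).inv₀ fun u => (hma u).ne'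
  have hha : ∀ u, h u ≤ a⁻¹ := fun u => inv_anti₀ ha (le_max_right _ _)
  -- The jump is replaced by a ramp over `[a, a + δ]` for the minorant and over `[a - δ, a]` for the
  -- majorant.
  set p₀ : ℝ → ℝ := fun u => h u * ramp ((u - a) / δ) with hp₀
  set q₀ : ℝ → ℝ := fun u => h u * ramp ((u - a) / δ + 1) with hq₀
  have hpc : Continuous p₀ := by fun_prop
  have hqc : Continuous q₀ := by fun_prop
  have hpg : ∀ u, p₀ u ≤ invAbove a u := by
    intro u
    rw [invAbove]
    split_ifs with hu
    · simp only [hp₀, hh, max_eq_left hu]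
      exact mul_le_of_le_one_right (inv_nonneg.2 (ha.le.trans hu)) (hr1 _)
    · simp only [hp₀]
      rw [hrneg _ (div_nonpos_of_nonpos_of_nonneg (by linarith) hδ0.le), mul_zero]
  have hgq : ∀ u, invAbove a u ≤ q₀ u := by
    intro u
    rw [invAbove]
    split_ifs with hu
    · simp only [hq₀, hh, max_eq_left hu]
      have : 0 ≤ (u - a) / δ := div_nonneg (by linarith) hδ0.le
      rw [hrone _ (by linarith), mul_one]
    · exact mul_nonneg (hh0 u).le (hr0 _)
  have hdiff : ∀ u, q₀ u - p₀ u ≤ (Metric.closedBall a δ).indicator (fun _ => a⁻¹) u := by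
    intro u
    by_cases hu : u ∈ Metric.closedBall a δ
    · rw [indicator_of_mem hu]
      have h1 : q₀ u ≤ h u := mul_le_of_le_one_right (hh0 u).le (hr1 _)
      have h2 : 0 ≤ p₀ u := mul_nonneg (hh0 u).le (hr0 _)
      linarith [hha u]
    · rw [indicator_of_notMem hu, sub_nonpos]
      rw [Metric.mem_closedBall, Real.dist_eq, not_le, lt_abs] at hu
      simp only [hp₀, hq₀]
      rcases hu with hu | hu
      · have : 1 ≤ (u - a) / δ := (one_le_div hδ0).2 hu.le
        rw [hrone _ this, hrone _ (by linarith)]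
      · have : (u - a) / δ ≤ -1 := by
          rw [div_le_iff₀ hδ0]
          linarith
        rw [hrneg _ (by linarith), hrneg _ (by linarith)]
  have hpi := integrable_of_continuous_of_mem_Icc hν hpc
  have hqi := integrable_of_continuous_of_mem_Icc hν hqc
  have hint : ∫ u, q₀ u ∂ν - ∫ u, p₀ u ∂ν < ε / 2 := by
    rw [← integral_sub hqi hpi]
    have h1 : ∫ u, (q₀ u - p₀ u) ∂ν ≤
        ∫ u, (Metric.closedBall a δ).indicator (fun _ => a⁻¹) u ∂ν :=
      integral_mono (hqi.sub hpi)
        ((integrable_const _).indicator Metric.isClosed_closedBall.measurableSet) hdiff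
    rw [integral_indicator Metric.isClosed_closedBall.measurableSet, setIntegral_const,
      smul_eq_mul] at h1
    refine h1.trans_lt ?_
    rwa [← div_eq_mul_inv, div_lt_iff₀ ha, mul_comm]
  -- Shifting by `ε / 8` before approximating within `ε / 8` keeps each polynomial on its side. Each
  -- costs at most `ε / 4` in the integral, beyond the gap `ε / 2`.
  obtain ⟨p, hp⟩ := exists_polynomial_near_of_continuousOn 0 1 (fun u => p₀ u - ε / 8)
    (by fun_prop) (ε / 8) (by positivity)
  obtain ⟨q, hq⟩ := exists_polynomial_near_of_continuousOn 0 1 (fun u => q₀ u + ε / 8)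
    (by fun_prop) (ε / 8) (by positivity)
  refine ⟨p, q, fun u hu => ?_, fun u hu => ?_, ?_⟩
  · have := (abs_lt.1 (hp u hu)).2
    linarith [hpg u]
  · have := (abs_lt.1 (hq u hu)).1
    linarith [hgq u]
  · have h1 : ∫ u, q.eval u ∂ν ≤ ∫ u, (q₀ u + ε / 4) ∂ν := by
      refine integral_mono_ae (integrable_of_continuous_of_mem_Icc hν q.continuous)
        (hqi.add (integrable_const _)) ?_
      filter_upwards [hν] with u hu
      have := (abs_lt.1 (hq u hu)).2
      linarith
    have h2 : ∫ u, (p₀ u - ε / 4) ∂ν ≤ ∫ u, p.eval u ∂ν := by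
      refine integral_mono_ae (hpi.sub (integrable_const _))
        (integrable_of_continuous_of_mem_Icc hν p.continuous) ?_
      filter_upwards [hν] with u hu
      have := (abs_lt.1 (hp u hu)).1
      linarith
    rw [integral_add hqi (integrable_const _)] at h1
    rw [integral_sub hpi (integrable_const _)] at h2
    simp only [integral_const, probReal_univ, smul_eq_mul, one_mul] at h1 h2
    linarith

/-! ### Partition sums and Karamata's theorem. -/

section Partition

variable {J : Type*} {a : J → ℝ}

/-- The partition function of a family of energies. -/
noncomputable def partitionSum (a : J → ℝ) (β : ℝ) : ℝ := ∑' j, Real.exp (-β * a j)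

theorem partitionSum_antitoneOn (ha : ∀ j, 0 < a j)
    (hsum : ∀ β, 0 < β → Summable fun j => Real.exp (-β * a j)) :
    AntitoneOn (partitionSum a) (Ioi 0) := by
  intro s hs t ht hst
  refine (hsum t ht).tsum_le_tsum (fun j => Real.exp_le_exp.2 ?_) (hsum s hs)
  nlinarith [ha j]

theorem partitionSum_pos [Nonempty J] (hsum : ∀ β, 0 < β → Summable fun j => Real.exp (-β * a j))
    {β : ℝ} (hβ : 0 < β) : 0 < partitionSum a β :=
  (hsum β hβ).tsum_pos (fun _ => (Real.exp_pos _).le) (Classical.arbitrary J) (Real.exp_pos _)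

/-- Any `n` of the terms have a sum tending to `n` as `β → 0⁺`. -/
theorem tendsto_partitionSum_atTop [Infinite J]
    (hsum : ∀ β, 0 < β → Summable fun j => Real.exp (-β * a j)) :
    Tendsto (partitionSum a) (𝓝[>] 0) atTop := by
  refine tendsto_atTop.2 fun M => ?_
  obtain ⟨n, hn⟩ := exists_nat_gt M
  obtain ⟨s, hs⟩ := Infinite.exists_subset_card_eq J n
  have h1 : Tendsto (fun β : ℝ => ∑ j ∈ s, Real.exp (-β * a j)) (𝓝[>] 0) (𝓝 (n : ℝ)) := by
    have hc : Continuous fun β : ℝ => ∑ j ∈ s, Real.exp (-β * a j) := by fun_prop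
    have := hc.tendsto 0
    simp only [neg_zero, zero_mul, Real.exp_zero, Finset.sum_const, hs, nsmul_eq_mul,
      mul_one] at this
    exact this.mono_left nhdsWithin_le_nhds
  filter_upwards [h1.eventually_const_lt hn, self_mem_nhdsWithin] with β hβ hβ0
  exact hβ.le.trans ((hsum β hβ0).sum_le_tsum s fun _ _ => (Real.exp_pos _).le)

theorem continuousOn_partitionSum (ha : ∀ j, 0 < a j)
    (hsum : ∀ β, 0 < β → Summable fun j => Real.exp (-β * a j)) :
    ContinuousOn (partitionSum a) (Ioi 0) := by
  intro β hβ
  have hβ' : 0 < β := hβ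
  have h : ContinuousOn (partitionSum a) (Ici (β / 2)) := by
    refine continuousOn_tsum (u := fun j => Real.exp (-(β / 2) * a j))
      (fun j => by fun_prop) (hsum _ (by positivity)) fun j x hx => ?_
    rw [Real.norm_eq_abs, Real.abs_exp, Real.exp_le_exp]
    nlinarith [ha j, mem_Ici.1 hx]
  exact (h.continuousAt (Ici_mem_nhds (by linarith))).continuousWithinAt

/-- Summability and asymptotics of the sums weighted by a polynomial. -/
theorem tendsto_weighted_polynomial [Nonempty J]
    (hsum : ∀ β, 0 < β → Summable fun j => Real.exp (-β * a j)) {d : ℝ}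
    (hd : ∀ s, 0 < s → Tendsto (fun β => partitionSum a (s * β) / partitionSum a β) (𝓝[>] 0)
      (𝓝 (s ^ (-d)))) {ν : Measure ℝ} [IsProbabilityMeasure ν]
    (hν : ∀ᵐ u ∂ν, u ∈ Icc (0 : ℝ) 1) (hmom : ∀ m : ℕ, ∫ u, u ^ m ∂ν = ((m : ℝ) + 1) ^ (-d))
    (p : Polynomial ℝ) :
    (∀ β, 0 < β → Summable fun j => Real.exp (-β * a j) * p.eval (Real.exp (-β * a j))) ∧
      Tendsto (fun β => (∑' j, Real.exp (-β * a j) * p.eval (Real.exp (-β * a j))) /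
        partitionSum a β) (𝓝[>] 0) (𝓝 (∫ u, p.eval u ∂ν)) := by
  induction p using Polynomial.induction_on' with
  | add p q hp hq =>
    simp only [Polynomial.eval_add, mul_add]
    refine ⟨fun β hβ => (hp.1 β hβ).add (hq.1 β hβ), ?_⟩
    rw [integral_add (integrable_of_continuous_of_mem_Icc hν p.continuous)
      (integrable_of_continuous_of_mem_Icc hν q.continuous)]
    refine (hp.2.add hq.2).congr' ?_
    filter_upwards [self_mem_nhdsWithin] with β hβ
    rw [(hp.1 β hβ).tsum_add (hq.1 β hβ), add_div]
  | monomial m c =>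
    -- The weight and the `m`-th power combine into the exponential at `(m + 1) * β`; this is the
    -- source of the shifted moments `(m + 1) ^ (-d)`.
    have hterm : ∀ β : ℝ, ∀ j, Real.exp (-β * a j) *
        (Polynomial.monomial m c).eval (Real.exp (-β * a j)) =
        c * Real.exp (-(((m : ℝ) + 1) * β) * a j) := by
      intro β j
      rw [Polynomial.eval_monomial, ← Real.exp_nat_mul, mul_left_comm, ← Real.exp_add]
      congr 2
      ring
    simp_rw [hterm]
    refine ⟨fun β hβ => (hsum _ (by positivity)).mul_left c, ?_⟩
    simp only [Polynomial.eval_monomial, integral_const_mul, hmom, tsum_mul_left, mul_div_assoc]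
    exact (hd _ (by positivity)).const_mul c

/-- **Karamata's Tauberian theorem** for sums of exponentials. -/
theorem exists_tendsto_ncard_div_partitionSum [Nonempty J] (ha : ∀ j, 0 < a j)
    (hfin : ∀ x, {j | a j ≤ x}.Finite)
    (hsum : ∀ β, 0 < β → Summable fun j => Real.exp (-β * a j))
    (hreg : ∀ s, 0 < s → ∃ k, 0 < k ∧
      Tendsto (fun β => partitionSum a (s * β) / partitionSum a β) (𝓝[>] 0) (𝓝 k)) :
    ∃ c : ℝ, 0 < c ∧ Tendsto (fun β => ({j | a j ≤ 1 / β}.ncard : ℝ) / partitionSum a β)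
      (𝓝[>] 0) (𝓝 c) := by
  obtain ⟨d, hd0, hd⟩ := exists_index_of_regularlyVarying
    (fun β => partitionSum_pos hsum) (partitionSum_antitoneOn ha hsum) hreg
  obtain ⟨ν, hprob, hν, hνa, hνpos, hmom⟩ := exists_measure_moments hd0
  have hpoly := tendsto_weighted_polynomial hsum hd hν hmom
  set e := Real.exp (-1) with he
  have he0 : 0 < e := Real.exp_pos _
  have hgi : Integrable (invAbove e) ν := integrable_invAbove he0
  -- The inverse cancels the weight, and the cutoff `exp (-1)` corresponds to `a j = 1 / β`, so the
  -- weighted sum is the counting function.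
  have hg : ∀ β, 0 < β → ∀ j, Real.exp (-β * a j) * invAbove e (Real.exp (-β * a j)) =
      {j | a j ≤ 1 / β}.indicator 1 j := by
    intro β hβ j
    have hiff : e ≤ Real.exp (-β * a j) ↔ a j ≤ 1 / β := by
      rw [he, Real.exp_le_exp, le_div_iff₀ hβ]
      constructor <;> intro h <;> nlinarith
    by_cases h : a j ≤ 1 / β
    · rw [invAbove, if_pos (hiff.2 h), mul_inv_cancel₀ (Real.exp_pos _).ne',
        indicator_of_mem (by exact h), Pi.one_apply]
    · rw [invAbove, if_neg (mt hiff.1 h), mul_zero, indicator_of_notMem (by exact h)]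
  have hcount : ∀ β, 0 < β →
      HasSum (fun j => Real.exp (-β * a j) * invAbove e (Real.exp (-β * a j)))
        ({j | a j ≤ 1 / β}.ncard : ℝ) := by
    intro β hβ
    simp_rw [hg β hβ]
    rw [← hasSum_subtype_iff_indicator]
    have := (hfin (1 / β)).fintype
    have h := hasSum_fintype fun _ : ({j | a j ≤ 1 / β} : Set J) => (1 : ℝ)
    rw [Finset.sum_const, Finset.card_univ, nsmul_eq_mul, mul_one, ← Nat.card_eq_fintype_card,
      Nat.card_coe_set_eq] at h
    exact h
  -- The constant is positive because the integrand is at least `1` on `[e, 1]`, where `ν` has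
  -- positive mass.
  refine ⟨∫ u, invAbove e u ∂ν, ?_, ?_⟩
  · have h1 : ∫ u, (Ici e).indicator (fun _ => (1 : ℝ)) u ∂ν ≤ ∫ u, invAbove e u ∂ν := by
      refine integral_mono_ae ((integrable_const _).indicator measurableSet_Ici) hgi ?_
      filter_upwards [hν] with u hu
      by_cases h : e ≤ u
      · rw [indicator_of_mem (mem_Ici.2 h), invAbove, if_pos h]
        exact (one_le_inv₀ (he0.trans_le h)).2 hu.2
      · rw [indicator_of_notMem (mt mem_Ici.1 h), invAbove, if_neg h]
    rw [integral_indicator measurableSet_Ici, setIntegral_const, smul_eq_mul, mul_one] at h1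
    exact (ENNReal.toReal_pos hνpos.ne' (measure_ne_top _ _)).trans_le h1
  · rw [Metric.tendsto_nhds]
    intro ε hε
    obtain ⟨p, q, hp, hq, hpq⟩ := exists_polynomial_sandwich hν he0 hνa (half_pos hε)
    have hpg : ∫ u, p.eval u ∂ν ≤ ∫ u, invAbove e u ∂ν :=
      integral_mono_ae (integrable_of_continuous_of_mem_Icc hν p.continuous) hgi
        (hν.mono fun u hu => hp u hu)
    have hgq : ∫ u, invAbove e u ∂ν ≤ ∫ u, q.eval u ∂ν :=
      integral_mono_ae hgi (integrable_of_continuous_of_mem_Icc hν q.continuous)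
        (hν.mono fun u hu => hq u hu)
    filter_upwards [Metric.tendsto_nhds.1 (hpoly p).2 (ε / 2) (half_pos hε),
      Metric.tendsto_nhds.1 (hpoly q).2 (ε / 2) (half_pos hε), self_mem_nhdsWithin]
      with β h1 h2 hβ
    have hβ' : 0 < β := hβ
    have hW := partitionSum_pos hsum hβ'
    have hmem : ∀ j, Real.exp (-β * a j) ∈ Icc (0 : ℝ) 1 := fun j =>
      ⟨(Real.exp_pos _).le, Real.exp_le_one_iff.2 (by nlinarith [ha j])⟩
    have h3 := div_le_div_of_nonneg_right (hasSum_le (fun j => mul_le_mul_of_nonneg_left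
      (hp _ (hmem j)) (Real.exp_pos _).le) ((hpoly p).1 β hβ').hasSum (hcount β hβ')) hW.le
    have h4 := div_le_div_of_nonneg_right (hasSum_le (fun j => mul_le_mul_of_nonneg_left
      (hq _ (hmem j)) (Real.exp_pos _).le) (hcount β hβ') ((hpoly q).1 β hβ').hasSum) hW.le
    rw [Real.dist_eq, abs_lt] at h1 h2 ⊢
    constructor <;> linarith

end Partition

/-! ### Density of the values of the counting function, and logarithmic means. -/

section Counting

variable {N : ℝ → ℝ}

/-- If `N` is asymptotically continuous and unbounded, its values are asymptotically dense. -/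
theorem IsAsymptoticallyContinuous.exists_between (hN : IsAsymptoticallyContinuous N)
    (htop : Tendsto N atTop atTop) {ε : ℝ} (hε : 0 < ε) :
    ∀ᶠ y : ℝ in atTop, ∃ x, y ≤ N x ∧ N x ≤ (1 + ε) * y := by
  obtain ⟨φ, hφc, hφ0, hφ⟩ := hN
  have hφtop : Tendsto φ atTop atTop := hφ.tendsto_atTop htop
  -- The intermediate value theorem gives `φ x = (1 + 2η) y`. A relative error `η` puts `N x`
  -- between `(1 - η)(1 + 2η) y ≥ y` and `(1 + η)(1 + 2η) y ≤ (1 + 4η) y ≤ (1 + ε) y`.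
  set η : ℝ := min (ε / 4) (1 / 4) with hη
  have hη0 : 0 < η := by positivity
  have hη1 : η ≤ 1 / 4 := min_le_right _ _
  have hη2 : η ≤ ε / 4 := min_le_left _ _
  have h1 := hφ.isLittleO.bound hη0
  obtain ⟨x₀, hx₀⟩ := eventually_atTop.1 h1
  set x₁ := max x₀ 0 with hx₁
  filter_upwards [eventually_ge_atTop (φ x₁), eventually_gt_atTop 0] with y hy hy0
  obtain ⟨x₂, hx₂, hx₂'⟩ := ((hφtop.eventually_ge_atTop ((1 + 2 * η) * y)).and
    (eventually_ge_atTop x₁)).exists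
  obtain ⟨x, hx, hxy⟩ := intermediate_value_Icc hx₂'
    (hφc.mono fun z hz => (le_max_right x₀ 0).trans hz.1)
    ⟨by nlinarith, hx₂⟩
  have h2 := hx₀ x ((le_max_left _ _).trans hx.1)
  rw [Pi.sub_apply, hxy, Real.norm_eq_abs, Real.norm_eq_abs,
    abs_of_nonneg (by positivity : 0 ≤ (1 + 2 * η) * y), abs_le] at h2
  refine ⟨x, ?_, ?_⟩
  · have : 0 ≤ η * (1 / 2 - η) * y := by
      have : 0 ≤ 1 / 2 - η := by linarith
      positivity
    nlinarith [h2.1]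
  · have : 0 ≤ η * (1 / 4 - η) * y := by
      have : 0 ≤ 1 / 4 - η := by linarith
      positivity
    nlinarith [h2.2, mul_le_mul_of_nonneg_right hη2 hy0.le]

end Counting

/-- Logarithmic means of a sequence asymptotic to the harmonic one. -/
theorem tendsto_log_mean_of_tendsto_mul {μ : ℕ → ℝ}
    (h : Tendsto (fun n : ℕ => (n : ℝ) * μ n) atTop (𝓝 1)) :
    Tendsto (fun N : ℕ => (Real.log N)⁻¹ * ∑ n ∈ Finset.Icc 1 N, μ n) atTop (𝓝 1) := by
  have hlog : Tendsto (fun N : ℕ => Real.log N) atTop atTop :=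
    Real.tendsto_log_atTop.comp tendsto_natCast_atTop_atTop
  set g : ℕ → ℝ := fun n => ((n : ℝ) + 1)⁻¹ with hg
  have hsumg : ∀ N, ∑ i ∈ Finset.range N, g i = (harmonic N : ℝ) := by
    intro N
    simp [harmonic, hg]
  have hH : Tendsto (fun N : ℕ => (harmonic N : ℝ) / Real.log N) atTop (𝓝 1) := by
    have h1 := Real.tendsto_harmonic_sub_log.div_atTop hlog
    have h2 := h1.add_const 1
    rw [zero_add] at h2
    refine h2.congr' ?_
    filter_upwards [hlog.eventually_gt_atTop 0] with N hN
    field_simp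
    ring
  have hsumtop : Tendsto (fun N => ∑ i ∈ Finset.range N, g i) atTop atTop := by
    simp_rw [hsumg]
    have := hH.pos_mul_atTop one_pos hlog
    refine this.congr' ?_
    filter_upwards [hlog.eventually_gt_atTop 0] with N hN
    field_simp
  -- Since the harmonic series diverges, this termwise little-o passes to partial sums, and harmonic
  -- numbers are asymptotic to `log N`.
  have hlittle : (fun n => μ (n + 1) - g n) =o[atTop] g := by
    refine (isLittleO_iff_tendsto fun n hn => ?_).2 ?_
    · exact absurd hn (by simp only [hg]; positivity)
    · have h1 := ((tendsto_add_atTop_iff_nat 1).2 h).sub_const 1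
      rw [sub_self] at h1
      refine h1.congr fun n => ?_
      simp only [hg, Nat.cast_add, Nat.cast_one]
      field_simp
  have hsum := hlittle.sum_range (fun n => by simp only [hg, Pi.zero_apply]; positivity) hsumtop
  have hquot := hsum.tendsto_div_nhds_zero
  have hfinal := (hquot.add_const 1).mul hH
  rw [zero_add, one_mul] at hfinal
  refine hfinal.congr' ?_
  filter_upwards [hlog.eventually_gt_atTop 0, hsumtop.eventually_gt_atTop 0] with N hN hN'
  have hμ : ∑ n ∈ Finset.Icc 1 N, μ n = ∑ i ∈ Finset.range N, μ (i + 1) := by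
    rw [Finset.range_eq_Ico, Finset.sum_Ico_add' μ 0 N 1]
    rfl
  rw [hμ, Finset.sum_sub_distrib, hsumg]
  rw [hsumg] at hN'
  field_simp
  ring

/-! ### Singular values and Dixmier traces of the spectral weight. -/

section Weight

variable {H : Type*} [NormedAddCommGroup H] [InnerProductSpace ℂ H] [CompleteSpace H]
  {L : H →ₗ.[ℂ] H}

namespace Eigenbasis

variable {ι : Type*} (B : Eigenbasis L ι)

theorem monotone_countingFunction (B : Eigenbasis L ι) : Monotone (countingFunction L) := by
  intro x y hxy
  rw [B.countingFunction_eq, B.countingFunction_eq]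
  exact_mod_cast ncard_le_ncard (fun j hj => le_trans hj hxy) (B.finite_eigenvalue_le y)

theorem tendsto_countingFunction (B : Eigenbasis L ι) [Infinite B.Index] :
    Tendsto (countingFunction L) atTop atTop := by
  refine tendsto_atTop_atTop_of_monotone B.monotone_countingFunction fun M => ?_
  obtain ⟨n, hn⟩ := exists_nat_gt M
  obtain ⟨s, hs⟩ := Infinite.exists_subset_card_eq B.Index n
  obtain ⟨x, hx⟩ := (s.finite_toSet.image fun j : B.Index => B.eigenvalue j).bddAbove
  refine ⟨x, hn.le.trans ?_⟩
  rw [B.countingFunction_eq, ← hs, ← ncard_coe_finset]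
  exact_mod_cast ncard_le_ncard (fun j hj => hx ⟨j, hj, rfl⟩) (B.finite_eigenvalue_le x)

theorem one_le_countingFunction (j : B.Index) :
    1 ≤ countingFunction L (B.eigenvalue j) := by
  rw [B.countingFunction_eq]
  have : 0 < {k : B.Index | B.eigenvalue k ≤ B.eigenvalue j}.ncard :=
    (ncard_pos (B.finite_eigenvalue_le _)).2 ⟨j, le_refl (B.eigenvalue j)⟩
  exact_mod_cast this

/-- The eigenvalues of the spectral weight. -/
noncomputable def weightValue (i : ι) : ℝ :=
  if B.resolventValue i < 1 then (countingFunction L (B.eigenvalue i))⁻¹ else 0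

theorem weight_apply_basis [Infinite B.Index] (i : ι) :
    weight L (B.basis i) = (B.weightValue i : ℂ) • B.basis i :=
  B.functionOf_apply_basis B.tendsto_countingFunction.inv_tendsto_atTop i

theorem inner_weight_symm (x y : H) : ⟪weight L x, y⟫_ℂ = ⟪x, weight L y⟫_ℂ :=
  ContinuousLinearMap.isSelfAdjoint_iff_isSymmetric.1 (IsSelfAdjoint.cfc : IsSelfAdjoint (weight L))
    x y

/-- Take the indices whose eigenvalue has counting value below `n`. If there are any, all lie at or
below the largest such eigenvalue, whose own counting value then bounds their number. Multiplicities
need no separate treatment. -/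
theorem exists_finset_weightValue_le [Infinite B.Index] {n : ℕ} (hn : 0 < n) :
    ∃ s : Finset ι, s.card < n ∧ ∀ i ∉ s, |B.weightValue i| ≤ (n : ℝ)⁻¹ := by
  classical
  obtain ⟨x, hx⟩ := (B.tendsto_countingFunction.eventually_ge_atTop (n : ℝ)).exists
  have hfin : {j : B.Index | countingFunction L (B.eigenvalue j) < n}.Finite := by
    refine (B.finite_eigenvalue_le x).subset fun j hj => ?_
    by_contra h
    exact absurd (hx.trans (B.monotone_countingFunction (not_le.1 h).le)) (not_le.2 hj)
  refine ⟨hfin.toFinset.map (Function.Embedding.subtype _), ?_, fun i hi => ?_⟩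
  · rw [Finset.card_map, ← ncard_eq_toFinset_card _ hfin]
    rcases eq_empty_or_nonempty {j : B.Index | countingFunction L (B.eigenvalue j) < n} with h | h
    · rw [h, ncard_empty]
      exact hn
    · obtain ⟨j, hj, hmax⟩ := exists_max_image _ (fun j : B.Index => B.eigenvalue j) hfin h
      have h1 : countingFunction L (B.eigenvalue j) < n := hj
      rw [B.countingFunction_eq] at h1
      exact (ncard_le_ncard (fun k hk => hmax k hk) (B.finite_eigenvalue_le _)).trans_lt
        (by exact_mod_cast h1)
  · rw [weightValue]
    split_ifs with h
    · have h1 : (n : ℝ) ≤ countingFunction L (B.eigenvalue i) := by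
        by_contra hlt
        refine hi (Finset.mem_map.2 ⟨⟨i, h⟩, ?_, rfl⟩)
        rw [Set.Finite.mem_toFinset]
        exact not_le.1 hlt
      have hn' : (0 : ℝ) < n := by exact_mod_cast hn
      rw [abs_inv, abs_of_pos (hn'.trans_le h1)]
      exact inv_anti₀ hn' h1
    · simp

theorem singularValue_weight_le [Infinite B.Index] {n : ℕ} (hn : 0 < n) :
    singularValue (weight L) n ≤ (n : ℝ)⁻¹ := by
  obtain ⟨s, hs, h⟩ := B.exists_finset_weightValue_le hn
  exact singularValue_le_of_diagonal inner_weight_symm B.weight_apply_basis hs (by positivity) h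

/-- At least `n` eigenvalues of `L` are at most `x`, and on each the weight is at least `1 /
N_L(x)`. -/
theorem le_singularValue_weight [Infinite B.Index] {n : ℕ} (hn : 0 < n) {x : ℝ}
    (hx : (n : ℝ) ≤ countingFunction L x) :
    (countingFunction L x)⁻¹ ≤ singularValue (weight L) n := by
  classical
  have hn' : (0 : ℝ) < n := by exact_mod_cast hn
  have hfin := B.finite_eigenvalue_le x
  refine le_singularValue_of_diagonal inner_weight_symm B.weight_apply_basis
    (s := hfin.toFinset.map (Function.Embedding.subtype _)) hn ?_ (inv_pos.2 (hn'.trans_le hx)) ?_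
  · rw [Finset.card_map, ← ncard_eq_toFinset_card _ hfin]
    rw [B.countingFunction_eq] at hx
    exact_mod_cast hx
  · intro i hi
    obtain ⟨j, hj, rfl⟩ := Finset.mem_map.1 hi
    rw [Set.Finite.mem_toFinset] at hj
    have h1 := one_pos.trans_le (B.one_le_countingFunction j)
    rw [Function.Embedding.subtype_apply, weightValue, if_pos (show B.resolventValue j < 1 from j.2),
      abs_inv, abs_of_pos h1]
    exact inv_anti₀ h1 (B.monotone_countingFunction hj)

/-- The weight is a norm limit of finite-rank truncations. -/
theorem isCompactOperator_weight [Infinite B.Index] : IsCompactOperator (weight L) := by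
  have hex : ∀ n : ℕ, ∃ s : Finset ι, ∀ i ∉ s, |B.weightValue i| ≤ ((n : ℝ) + 1)⁻¹ := by
    intro n
    obtain ⟨s, -, h⟩ := B.exists_finset_weightValue_le n.succ_pos
    exact ⟨s, by simpa using h⟩
  choose s hs using hex
  have hlim : Tendsto (fun n => diagonalOn B.basis B.weightValue (s n)) atTop (𝓝 (weight L)) := by
    rw [tendsto_iff_norm_sub_tendsto_zero]
    refine squeeze_zero (fun _ => norm_nonneg _) (fun n => ?_)
      (tendsto_one_div_add_atTop_nhds_zero_nat (𝕜 := ℝ))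
    rw [norm_sub_rev, one_div]
    exact norm_sub_diagonalOn_le inner_weight_symm B.weight_apply_basis (by positivity) (hs n)
  exact isCompactOperator_of_tendsto hlim (.of_forall fun n => isCompactOperator_diagonalOn _)

/-- The upper bound is `μₙ ≤ 1/n`; the lower bound evaluates the counting function at a point where
it lies between `n` and `(1 + ε) n`. -/
theorem tendsto_mul_singularValue_weight [Infinite B.Index]
    (hN : IsAsymptoticallyContinuous (countingFunction L)) :
    Tendsto (fun n : ℕ => (n : ℝ) * singularValue (weight L) n) atTop (𝓝 1) := by
  refine tendsto_order.2 ⟨fun c hc => ?_, fun c hc => ?_⟩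
  · obtain ⟨ε, hε, hεc⟩ : ∃ ε > 0, c < (1 + ε)⁻¹ := by
      have h1 : Tendsto (fun ε : ℝ => (1 + ε)⁻¹) (𝓝[>] 0) (𝓝 1) := by
        have : ContinuousAt (fun ε : ℝ => (1 + ε)⁻¹) 0 :=
          (continuousAt_const.add continuousAt_id).inv₀ (by simp)
        have h2 := this.tendsto
        rw [add_zero, inv_one] at h2
        exact h2.mono_left nhdsWithin_le_nhds
      obtain ⟨ε, h3, h4⟩ := ((h1.eventually_const_lt hc).and self_mem_nhdsWithin).exists
      exact ⟨ε, h4, h3⟩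
    filter_upwards [tendsto_natCast_atTop_atTop.eventually
      (hN.exists_between B.tendsto_countingFunction hε), eventually_gt_atTop 0] with n hx hn
    obtain ⟨x, h1, h2⟩ := hx
    have hn' : (0 : ℝ) < n := by exact_mod_cast hn
    refine hεc.trans_le ?_
    have h3 : ((1 + ε) * n)⁻¹ ≤ singularValue (weight L) n :=
      (inv_anti₀ (hn'.trans_le h1) h2).trans (B.le_singularValue_weight hn h1)
    have h4 := mul_le_mul_of_nonneg_left h3 hn'.le
    refine le_trans (le_of_eq ?_) h4
    field_simp
  · filter_upwards [eventually_gt_atTop 0] with n hn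
    have hn' : (0 : ℝ) < n := by exact_mod_cast hn
    have h1 := mul_le_mul_of_nonneg_left (B.singularValue_weight_le hn) hn'.le
    rw [mul_inv_cancel₀ hn'.ne'] at h1
    exact h1.trans_lt hc

end Eigenbasis

/-- Half-lines are not null. Nontriviality is what identifies `liminf` and `limsup` with the limit.
-/
instance : NeBot essAtTop := by
  refine inf_neBot_iff.2 fun {s} hs {t} ht => ?_
  obtain ⟨a, ha⟩ := mem_atTop_sets.1 hs
  by_contra hempty
  rw [not_nonempty_iff_eq_empty] at hempty
  have hsub : Ici (max a 1) ⊆ tᶜ := by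
    intro x hx hxt
    exact (hempty ▸ (⟨ha x ((le_max_left _ _).trans hx), hxt⟩ : x ∈ s ∩ t) : x ∈ (∅ : Set ℝ))
  have h0 : posMeasure (Ici (max a 1)) = 0 := measure_mono_null hsub ht
  rw [posMeasure, Measure.restrict_apply measurableSet_Ici, inter_eq_left.2] at h0
  · simp at h0
  · exact fun x hx => one_pos.trans_le ((le_max_right a 1).trans hx)

/-- Convergent means are bounded, so they define a class in `L^∞`, and `ω` is squeezed between equal
lower and upper limits. -/
theorem dixmierTrace_eq_of_tendsto {T : H →L[ℂ] H} {c : ℝ}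
    (h : Tendsto (logMean T) atTop (𝓝 c)) (ω : DixmierState) : dixmierTrace ω T = c := by
  obtain ⟨C, hC⟩ := (Metric.isBounded_range_of_tendsto _ h).exists_norm_le
  have hmem : MemLp (fun t : ℝ => logMean T ⌊t⌋₊) ∞ posMeasure := by
    refine memLp_top_of_bound ?_ C (ae_of_all _ fun t => hC _ ⟨_, rfl⟩)
    exact ((measurable_from_nat (f := logMean T)).comp Nat.measurable_floor).aestronglyMeasurable
  have hlim : Tendsto (hmem.toLp : ℝ → ℝ) essAtTop (𝓝 c) := by
    have h1 : Tendsto (fun t : ℝ => logMean T ⌊t⌋₊) essAtTop (𝓝 c) :=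
      (h.comp tendsto_nat_floor_atTop).mono_left inf_le_left
    refine h1.congr' ?_
    have h2 : ∀ᶠ t in ae posMeasure, (hmem.toLp : ℝ → ℝ) t = logMean T ⌊t⌋₊ := hmem.coeFn_toLp
    exact (h2.filter_mono inf_le_right).mono fun t ht => ht.symm
  rw [dixmierTrace, dif_pos hmem]
  refine le_antisymm ?_ ?_
  · rw [← hlim.limsup_eq]
    exact ω.le_limsup _
  · rw [← hlim.liminf_eq]
    exact ω.liminf_le _

theorem Eigenbasis.weightIsDensity {ι : Type*} (B : Eigenbasis L ι) [Infinite B.Index]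
    (hN : IsAsymptoticallyContinuous (countingFunction L)) : WeightIsDensity L := by
  have hlim : Tendsto (logMean (weight L)) atTop (𝓝 1) :=
    tendsto_log_mean_of_tendsto_mul (B.tendsto_mul_singularValue_weight hN)
  refine ⟨⟨⟨B.isCompactOperator_weight, ?_⟩, fun ω ω' => ?_⟩,
    fun ω => dixmierTrace_eq_of_tendsto hlim ω⟩
  · exact hlim.bddAbove_range.mono (image_subset_range _ _)
  · rw [dixmierTrace_eq_of_tendsto hlim, dixmierTrace_eq_of_tendsto hlim]

end Weight

/-! ### Removing the kernel term, and the conclusion. -/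

/-- Adding a constant does not affect the regular variation of an unbounded function. -/
theorem tendsto_quotient_of_add_const {W : ℝ → ℝ} (hW : Tendsto W (𝓝[>] 0) atTop) (d : ℝ)
    {s k : ℝ} (hs : 0 < s)
    (h : Tendsto (fun β => (W (s * β) + d) / (W β + d)) (𝓝[>] 0) (𝓝 k)) :
    Tendsto (fun β => W (s * β) / W β) (𝓝[>] 0) (𝓝 k) := by
  have hscale := tendsto_const_mul_nhdsGT_zero hs
  have h1 : Tendsto (fun β => (W β + d) / W β) (𝓝[>] 0) (𝓝 1) := by
    have h2 := (tendsto_const_nhds (x := d)).div_atTop hW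
    have h3 := h2.const_add 1
    rw [add_zero] at h3
    refine h3.congr' ?_
    filter_upwards [hW.eventually_gt_atTop 0] with β hβ
    field_simp
  -- The ratio for `W` is the ratio for `W + d`, times the correction at `β`, divided by the
  -- correction at `s * β`; both corrections tend to `1`.
  have h2 := (h.mul h1).mul ((h1.comp hscale).inv₀ one_ne_zero)
  rw [mul_one, inv_one, mul_one] at h2
  refine h2.congr' ?_
  have h3 := hW.eventually_gt_atTop (max 0 (-d))
  filter_upwards [h3, hscale.eventually h3] with β hβ hβ'
  have a1 := (le_max_left _ _).trans_lt hβ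
  have a2 := (le_max_right _ _).trans_lt hβ
  have a3 := (le_max_left _ _).trans_lt hβ'
  have a4 := (le_max_right _ _).trans_lt hβ'
  have a5 : 0 < W β + d := by linarith
  have a6 : 0 < W (s * β) + d := by linarith
  simp only [Function.comp_apply]
  field_simp

theorem exists_eigenbasis_structure.{u} {H : Type u} [NormedAddCommGroup H]
    [InnerProductSpace ℂ H] [CompleteSpace H] {L : H →ₗ.[ℂ] H} (hself : IsSelfAdjoint L)
    (hnonneg : IsNonnegOp L) (hdisc : HasDiscreteSpectrumOffKernel L) :
    ∃ ι : Type u, Nonempty (Eigenbasis L ι) := by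
  obtain ⟨ι, b, r, h1, h2, h3⟩ := exists_eigenbasis hself hnonneg hdisc
  exact ⟨ι, ⟨⟨b, r, fun i => (h1 i).1, fun i => (h1 i).2, h2, h3,
    ContinuousLinearMap.isSelfAdjoint_iff_isSymmetric.2
      ((isResolvent_resolvent hself hnonneg).isSymmetric hself)⟩⟩⟩

end SpectralWeight

theorem proposition2p9 {H : Type*} [NormedAddCommGroup H] [InnerProductSpace ℂ H]
    [CompleteSpace H] (L : H →ₗ.[ℂ] H) (hdense : Dense (L.domain : Set H))
    (hself : IsSelfAdjoint L) (hnonneg : IsNonnegOp L) (hunb : IsUnboundedOp L)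
    (hdisc : HasDiscreteSpectrumOffKernel L)
    -- `S t = e^{-tL}`, with either convention on the kernel of `L`
    (S : ℝ → H →L[ℂ] H) (hS : S = heatSemigroup L ∨ S = heatSemigroupOffKernel L)
    (hnuclear : ∀ β : ℝ, 0 < β → SpectralWeight.trace (S β) < ∞)
    (Z : ℝ → ℝ) (hZ : ∀ β : ℝ, 0 < β → Z β = (SpectralWeight.trace (S β)).toReal)
    (hreg : IsRegularlyVaryingAtZero Z) :
    (∃ c : ℝ, 0 < c ∧ countingFunction L ~[atTop] fun x => c * Z (1 / x)) ∧
      IsAsymptoticallyContinuous (countingFunction L) ∧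
      WeightIsDensity L := by
  obtain ⟨ι, ⟨B⟩⟩ := exists_eigenbasis_structure hself hnonneg hdisc
  have hinf : Infinite B.Index := B.infinite_index hself hnonneg hunb
  set a : B.Index → ℝ := fun j => B.eigenvalue j with ha
  -- `D` is the number of kernel basis vectors, or `0` in the other convention; nuclearity makes it
  -- finite.
  obtain ⟨D, hD⟩ : ∃ D : ℝ≥0∞, ∀ β, 0 < β → SpectralWeight.trace (S β) =
      ∑' j, ENNReal.ofReal (Real.exp (-β * a j)) + D := by
    rcases hS with rfl | rfl
    · exact ⟨_, fun β hβ => B.trace_heatSemigroup hβ⟩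
    · exact ⟨0, fun β hβ => by rw [add_zero]; exact B.trace_heatSemigroupOffKernel hβ⟩
  have hfinite : ∀ β, 0 < β → ∑' j, ENNReal.ofReal (Real.exp (-β * a j)) ≠ ∞ ∧ D ≠ ∞ := by
    intro β hβ
    have h := hnuclear β hβ
    rw [hD β hβ, ENNReal.add_lt_top] at h
    exact ⟨h.1.ne, h.2.ne⟩
  have hsum : ∀ β, 0 < β → Summable fun j => Real.exp (-β * a j) := by
    intro β hβ
    refine (ENNReal.summable_toReal (hfinite β hβ).1).congr fun j => ?_
    rw [ENNReal.toReal_ofReal (Real.exp_pos _).le]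
  have hZW : ∀ β, 0 < β → Z β = partitionSum a β + D.toReal := by
    intro β hβ
    rw [hZ β hβ, hD β hβ, ENNReal.toReal_add (hfinite β hβ).1 (hfinite β hβ).2,
      ENNReal.tsum_toReal_eq (fun _ => ENNReal.ofReal_ne_top), partitionSum]
    congr 1
    exact tsum_congr fun j => ENNReal.toReal_ofReal (Real.exp_pos _).le
  have hWtop := tendsto_partitionSum_atTop hsum
  have hregW : ∀ s, 0 < s → ∃ k, 0 < k ∧
      Tendsto (fun β => partitionSum a (s * β) / partitionSum a β) (𝓝[>] 0) (𝓝 k) := by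
    intro s hs
    obtain ⟨k, hk, h⟩ := hreg.2 s hs
    refine ⟨k, hk, tendsto_quotient_of_add_const hWtop D.toReal hs (h.congr' ?_)⟩
    filter_upwards [self_mem_nhdsWithin] with β hβ
    rw [hZW β hβ, hZW _ (mul_pos hs hβ)]
  obtain ⟨c, hc, hlim⟩ := exists_tendsto_ncard_div_partitionSum (a := a)
    B.eigenvalue_pos B.finite_eigenvalue_le hsum hregW
  have hZ1 : Tendsto (fun β => partitionSum a β / (partitionSum a β + D.toReal)) (𝓝[>] 0) (𝓝 1) := by
    have h2 := ((tendsto_const_nhds (x := D.toReal)).div_atTop hWtop).const_add 1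
    have h3 := h2.inv₀ (by simp)
    rw [add_zero, inv_one] at h3
    refine h3.congr' ?_
    filter_upwards [hWtop.eventually_gt_atTop 0] with β hβ
    have : 0 < partitionSum a β + D.toReal := by positivity
    field_simp
  have hasymp : countingFunction L ~[atTop] fun x => c * Z (1 / x) := by
    refine isEquivalent_of_tendsto_one ?_
    have h1 := ((hlim.mul hZ1).const_mul c⁻¹).comp (tendsto_inv_atTop_nhdsGT_zero (𝕜 := ℝ))
    rw [mul_one, inv_mul_cancel₀ hc.ne'] at h1
    refine h1.congr' ?_
    filter_upwards [eventually_gt_atTop 0] with x hx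
    have hx' : 0 < x⁻¹ := inv_pos.2 hx
    have hW := partitionSum_pos hsum hx'
    have : 0 < partitionSum a x⁻¹ + D.toReal := by positivity
    rw [Pi.div_apply, B.countingFunction_eq, one_div, hZW _ hx']
    simp only [Function.comp_apply, one_div, inv_inv]
    change _ = ({j | a j ≤ x}.ncard : ℝ) / _
    generalize partitionSum a x⁻¹ = w at *
    field_simp
  have hcont : IsAsymptoticallyContinuous (countingFunction L) := by
    -- The partition sum is continuous on `(0, ∞)`; cutting `x` off at `1` keeps its argument
    -- positive down to `x = 0` without changing anything at infinity.
    refine ⟨fun x => c * (partitionSum a (max x 1)⁻¹ + D.toReal), ?_, fun x _ => ?_, ?_⟩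
    · have hmax : ∀ x : ℝ, 0 < max x 1 := fun x => lt_max_of_lt_right one_pos
      have h1 : Continuous fun x : ℝ => (max x 1)⁻¹ :=
        (continuous_id.max continuous_const).inv₀ fun x => (hmax x).ne'
      have h2 : Continuous fun x : ℝ => partitionSum a (max x 1)⁻¹ :=
        (continuousOn_partitionSum B.eigenvalue_pos hsum).comp_continuous h1
          fun x => inv_pos.2 (hmax x)
      exact ((h2.add continuous_const).const_mul c).continuousOn
    · have : 0 ≤ partitionSum a (max x 1)⁻¹ := tsum_nonneg fun _ => (Real.exp_pos _).le
      positivity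
    · refine hasymp.congr_right ?_
      filter_upwards [eventually_ge_atTop 1] with x hx
      have hx' : 0 < x := by linarith
      rw [max_eq_left hx, one_div, hZW _ (inv_pos.2 hx')]
  exact ⟨⟨c, hc, hasymp⟩, hcont, B.weightIsDensity hcont⟩
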